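/- Let $\Gamma$ be a bipartite distance-regular graph with vertex set $X$, path-length distance $\partial$, even diameter $D\ge 4$, valency $k\ge 3$ and intersection numbers $p^h_{ij}$; put $c_i=p^i_{1,i-1}$, $b_i=p^i_{1,i+1}$, $k_i=p^0_{ii}$ (so $k=k_1$). Let $A_i\in\mathrm{Mat}_X(\mathbb C)$ be the $i$-th distance matrix, $A=A_1$, let $\theta_0>\theta_1>\cdots>\theta_D$ be the distinct eigenvalues of $A$, put $d=D/2$ and $\tilde\theta_d=-1-b_2b_3(\theta_d^2-b_2)^{-1}$. Define $f_0,\dots,f_D\in\mathbb R[\lambda]$ by $f_{-1}=0$, $f_0=1$ and $\lambda f_i=b_{i-1}f_{i-1}+c_{i+1}f_{i+1}$ $(0\le i\le D-1)$; let $p_i=f_i+f_{i-2}+f_{i-4}+\cdots$ (ending in $f_0$ or $f_1$), and let $P_i\in\mathbb R[\lambda]$ be the polynomial with $p_i(\lambda)=P_i(\lambda^2)$ if $i$ is even and $p_i(\lambda)=\lambda P_i(\lambda^2)$ if $i$ is odd. Fix $x\in X$. For $0\le i\le D$ let $E^*_i$ be the diagonal matrix whose $(y,y)$-entry is $1$ if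 $\partial(x,y)=i$ and $0$ otherwise, and let $T\subseteq\mathrm{Mat}_X(\mathbb C)$ be the subalgebra generated by $A,E^*_0,\dots,E^*_D$. A $T$-module is a subspace of $\mathbb C^X$ (with its Hermitian inner product) invariant under $T$; it is irreducible if it is nonzero and has no $T$-submodules other than $0$ and itself. Let $W$ be an irreducible $T$-module that is thin ($\dim E^*_iW\le 1$ for $0\le i\le D$), has endpoint $2$ ($\min\{i: E^*_iW\ne0\}=2$), and has local eigenvalue $\tilde\theta_d$ ($E^*_2A_2E^*_2$ acts on the line $E^*_2W$ as the scalar $\tilde\theta_d$). Let $v$ be a nonzero vector in $E^*_2W$. Then $P_i(0)\neq 0$ for $0\le i\le D-2$, and: (i) for $0\le i\le D-2$, $$E^*_{i+2}A_iv=\sum_{\substack{0\le h\le i\\ i-h\ \mathrm{even}}}\frac{P_h(0)}{P_i(0)}\,\frac{k_ib_ib_{i+1}}{k_hb_hb_{h+1}}\,p_h(A)v ,$$ and both sides are zero for $i=D-2$; (ii) the vectors $E^*_{i+2}A_iv$ $(0\le i\le D-3)$ form a basis of $W$; (iii) these vectors are mutually orthogonal, and for $0\le i\le D-3$ $$\|E^*_{i+2}A_iv\|^2=-\frac{k_ib_ib_{i+1}c_{i+1}c_{i+2}}{k\,b_1b_2}\,\frac{P_{i+2}(0)}{P_i(0)}\,\|v\|^2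 .$$ -/

import Mathlib

namespace SimpleGraph

noncomputable section

variable {X : Type*} [Fintype X] [DecidableEq X]

/-! ### Distance-regular graphs -/

/-- `|{z : ∂(x,z) = i, ∂(z,y) = j}|`. -/
def distCount (Γ : SimpleGraph X) (i j : ℕ) (x y : X) : ℕ :=
  (Finset.univ.filter fun z => Γ.dist x z = i ∧ Γ.dist z y = j).card

/-- `Γ` is connected and the number `distCount i j x y` depends only on `i`, `j` and `∂(x,y)`. -/
structure IsDistanceRegular (Γ : SimpleGraph X) : Prop where
  connected : Γ.Connected
  distCount_eq : ∀ h i j : ℕ, h ≤ Γ.diam → i ≤ Γ.diam → j ≤ Γ.diam → ∀ x y x' y' : X,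
    Γ.dist x y = h → Γ.dist x' y' = h → Γ.distCount i j x y = Γ.distCount i j x' y'

open Classical in
/-- The intersection number `p^h_{ij}`, read off from some pair at distance `h`
(`0` if there is no such pair, that is, if `h > D`). -/
def intersectionNumber (Γ : SimpleGraph X) (h i j : ℕ) : ℕ :=
  if H : ∃ xy : X × X, Γ.dist xy.1 xy.2 = h then Γ.distCount i j H.choose.1 H.choose.2 else 0

/-- In a distance-regular graph the intersection number counts as it should for every pair. -/
theorem IsDistanceRegular.distCount_eq_intersectionNumber {Γ : SimpleGraph X}
    (hΓ : Γ.IsDistanceRegular) {h i j : ℕ} (hh : h ≤ Γ.diam) (hi : i ≤ Γ.diam) (hj : j ≤ Γ.diam)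
    {x y : X} (hxy : Γ.dist x y = h) :
    Γ.distCount i j x y = Γ.intersectionNumber h i j := by
  have H : ∃ xy : X × X, Γ.dist xy.1 xy.2 = h := ⟨(x, y), hxy⟩
  rw [intersectionNumber, dif_pos H]
  exact hΓ.distCount_eq h i j hh hi hj _ _ _ _ hxy H.choose_spec

/-- `b_i = p^i_{1,i+1}`; there is no vertex at distance `D + 1`, so `b_D = 0`. -/
def bNum (Γ : SimpleGraph X) (i : ℕ) : ℝ := Γ.intersectionNumber i 1 (i + 1)

/-- `c_0 = 0` and `c_i = p^i_{1,i-1}` for `i ≥ 1`. -/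
def cNum (Γ : SimpleGraph X) : ℕ → ℝ
  | 0 => 0
  | i + 1 => Γ.intersectionNumber (i + 1) 1 i

/-- `k_i = p^0_{ii}`; the valency of `Γ` is `k_1`. -/
def kNum (Γ : SimpleGraph X) (i : ℕ) : ℝ := Γ.intersectionNumber 0 i i

/-- The `i`-th distance matrix `A_i`, with entries in `R`; the adjacency matrix is `A_1`. -/
def distMatrix (R : Type*) [Zero R] [One R] (Γ : SimpleGraph X) (i : ℕ) : Matrix X X R :=
  Matrix.of fun x y => if Γ.dist x y = i then 1 else 0

/-- The `i`-th entry of the list `θ_0 > θ_1 > ⋯` of the distinct eigenvalues of the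
adjacency matrix (a real symmetric matrix) in decreasing order. -/
def theta (Γ : SimpleGraph X) (i : ℕ) : ℝ :=
  ((Γ.distMatrix ℝ 1).charpoly.roots.toFinset.sort (· ≥ ·)).getD i 0

/-- `z̃ = -1 - b_2 b_3 / (z² - b_2)`, for real `z` with `z² ≠ b_2`. -/
def tilde (Γ : SimpleGraph X) (z : ℝ) : ℝ :=
  -1 - Γ.bNum 2 * Γ.bNum 3 / (z ^ 2 - Γ.bNum 2)

/-! ### Polynomials -/

open Polynomial in
/-- The polynomials with `f_0 = 1` and `λ f_i = b_{i-1} f_{i-1} + c_{i+1} f_{i+1}`, `f_{-1} = 0`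
(meaningful for `i ≤ D`, where `c_1, …, c_D` are nonzero). -/
def fPoly (Γ : SimpleGraph X) : ℕ → ℝ[X]
  | 0 => 1
  | 1 => C (Γ.cNum 1)⁻¹ * Polynomial.X
  | i + 2 => C (Γ.cNum (i + 2))⁻¹ *
      (Polynomial.X * fPoly Γ (i + 1) - C (Γ.bNum i) * fPoly Γ i)

open Polynomial in
/-- `p_i = f_i + f_{i-2} + f_{i-4} + ⋯`, ending in `f_0` or `f_1`. -/
def pPoly (Γ : SimpleGraph X) (i : ℕ) : ℝ[X] :=
  ∑ j ∈ Finset.range (i + 1) with j % 2 = i % 2, Γ.fPoly j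

open Polynomial in
/-- The polynomial `P_i` with `p_i(λ) = P_i(λ²)` if `i` is even and `p_i(λ) = λ P_i(λ²)` if `i` is
odd; see `pPoly_eq_of_even` and `pPoly_eq_of_odd`. -/
def PPoly (Γ : SimpleGraph X) (i : ℕ) : ℝ[X] :=
  if Even i then contract 2 (Γ.pPoly i) else contract 2 (Γ.pPoly i).divX

theorem fPoly_coeff_eq_zero (Γ : SimpleGraph X) :
    ∀ i n : ℕ, n % 2 ≠ i % 2 → (Γ.fPoly i).coeff n = 0
  | 0, n, h => by
      have : n ≠ 0 := by rintro rfl; exact h rfl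
      simp [fPoly, Polynomial.coeff_one, this]
  | 1, n, h => by
      have : 1 ≠ n := by rintro rfl; exact h rfl
      simp [fPoly, Polynomial.coeff_X, this]
  | i + 2, n, h => by
      have h0 : (Γ.fPoly i).coeff n = 0 := fPoly_coeff_eq_zero Γ i n (by omega)
      rw [fPoly, Polynomial.coeff_C_mul, Polynomial.coeff_sub, Polynomial.coeff_C_mul, h0]
      cases n with
      | zero => simp
      | succ n =>
        have h1 : (Γ.fPoly (i + 1)).coeff n = 0 := fPoly_coeff_eq_zero Γ (i + 1) n (by omega)
        simp [Polynomial.coeff_X_mul, h1]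

theorem pPoly_coeff_eq_zero (Γ : SimpleGraph X) (i n : ℕ) (h : n % 2 ≠ i % 2) :
    (Γ.pPoly i).coeff n = 0 := by
  rw [pPoly, Polynomial.finsetSum_coeff]
  refine Finset.sum_eq_zero fun j hj => fPoly_coeff_eq_zero Γ j n ?_
  rw [Finset.mem_filter] at hj
  omega

theorem pPoly_eq_of_even (Γ : SimpleGraph X) {i : ℕ} (hi : Even i) :
    Γ.pPoly i = (Γ.PPoly i).comp (Polynomial.X ^ 2) := by
  rw [← Polynomial.expand_eq_comp_X_pow, PPoly, if_pos hi]
  ext n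
  rw [Polynomial.coeff_expand two_pos]
  split_ifs with h
  · rw [Polynomial.coeff_contract two_ne_zero, Nat.div_mul_cancel h]
  · rw [Nat.even_iff] at hi
    exact pPoly_coeff_eq_zero Γ i n (by omega)

theorem pPoly_eq_of_odd (Γ : SimpleGraph X) {i : ℕ} (hi : Odd i) :
    Γ.pPoly i = Polynomial.X * (Γ.PPoly i).comp (Polynomial.X ^ 2) := by
  rw [← Polynomial.expand_eq_comp_X_pow, PPoly, if_neg (Nat.not_even_iff_odd.mpr hi)]
  rw [Nat.odd_iff] at hi
  ext n
  cases n with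
  | zero => simpa using pPoly_coeff_eq_zero Γ i 0 (by omega)
  | succ n =>
    rw [Polynomial.coeff_X_mul, Polynomial.coeff_expand two_pos]
    split_ifs with h
    · rw [Polynomial.coeff_contract two_ne_zero, Nat.div_mul_cancel h, Polynomial.coeff_divX]
    · exact pPoly_coeff_eq_zero Γ i (n + 1) (by omega)

/-! ### The subconstituent algebra and its modules

The standard module is `EuclideanSpace ℂ X`; a matrix `B` acts on it as `Matrix.toEuclideanLin B`.
-/

/-- The dual idempotent `E*_i` with respect to the base vertex `x`. -/
def dualIdempotent (Γ : SimpleGraph X) (x : X) (i : ℕ) : Matrix X X ℂ :=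
  Matrix.diagonal fun y => if Γ.dist x y = i then 1 else 0

/-- The Bose-Mesner algebra, generated by the adjacency matrix. -/
def boseMesner (Γ : SimpleGraph X) : Subalgebra ℂ (Matrix X X ℂ) :=
  Algebra.adjoin ℂ {Γ.distMatrix ℂ 1}

/-- The dual Bose-Mesner algebra, generated (in fact spanned) by `E*_0, …, E*_D`. -/
def dualBoseMesner (Γ : SimpleGraph X) (x : X) : Subalgebra ℂ (Matrix X X ℂ) :=
  Algebra.adjoin ℂ {B | ∃ i ≤ Γ.diam, B = Γ.dualIdempotent x i}

/-- The subconstituent (Terwilliger) algebra `T(x)`. -/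
def subconstituentAlgebra (Γ : SimpleGraph X) (x : X) : Subalgebra ℂ (Matrix X X ℂ) :=
  Γ.boseMesner ⊔ Γ.dualBoseMesner x

/-- `W` is a `T(x)`-module. -/
def IsTModule (Γ : SimpleGraph X) (x : X) (W : Submodule ℂ (EuclideanSpace ℂ X)) : Prop :=
  ∀ B ∈ Γ.subconstituentAlgebra x, ∀ w ∈ W, Matrix.toEuclideanLin B w ∈ W

/-- `W` is an irreducible `T(x)`-module. -/
def IsIrreducibleTModule (Γ : SimpleGraph X) (x : X)
    (W : Submodule ℂ (EuclideanSpace ℂ X)) : Prop :=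
  Γ.IsTModule x W ∧ W ≠ ⊥ ∧ ∀ W' ≤ W, Γ.IsTModule x W' → W' = ⊥ ∨ W' = W

/-- The subspace `E*_i W`. -/
def dualPart (Γ : SimpleGraph X) (x : X) (W : Submodule ℂ (EuclideanSpace ℂ X)) (i : ℕ) :
    Submodule ℂ (EuclideanSpace ℂ X) :=
  W.map (Matrix.toEuclideanLin (Γ.dualIdempotent x i))

/-- `dim E*_i W ≤ 1` for `0 ≤ i ≤ D`. -/
def IsThin (Γ : SimpleGraph X) (x : X) (W : Submodule ℂ (EuclideanSpace ℂ X)) : Prop :=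
  ∀ i ≤ Γ.diam, Module.finrank ℂ (Γ.dualPart x W i) ≤ 1

/-- `r` is the endpoint `min {i | 0 ≤ i ≤ D, E*_i W ≠ 0}` of `W`. -/
def HasEndpoint (Γ : SimpleGraph X) (x : X) (W : Submodule ℂ (EuclideanSpace ℂ X))
    (r : ℕ) : Prop :=
  IsLeast {i | i ≤ Γ.diam ∧ Γ.dualPart x W i ≠ ⊥} r

/-- `E*_2 A_2 E*_2` acts on `E*_2 W` as the scalar `η`. For `W` thin with endpoint `2` this says
that `η` is the local eigenvalue of `W`, since `E*_2 W` is then one-dimensional. -/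
def HasLocalEigenvalue (Γ : SimpleGraph X) (x : X) (W : Submodule ℂ (EuclideanSpace ℂ X))
    (η : ℝ) : Prop :=
  ∀ w ∈ Γ.dualPart x W 2,
    Matrix.toEuclideanLin
      (Γ.dualIdempotent x 2 * Γ.distMatrix ℂ 2 * Γ.dualIdempotent x 2) w = (η : ℂ) • w

/-- The vector `E*_{i+2} A_i v`. -/
def dualVec (Γ : SimpleGraph X) (x : X) (v : EuclideanSpace ℂ X) (i : ℕ) : EuclideanSpace ℂ X :=
  Matrix.toEuclideanLin (Γ.dualIdempotent x (i + 2) * Γ.distMatrix ℂ i) v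

end

end SimpleGraph

namespace SimpleGraph

set_option linter.unusedSectionVars false

variable {X : Type*} [Fintype X] [DecidableEq X]

/-! ### Distances in connected bipartite graphs -/

section Distance

variable {Γ : SimpleGraph X}

/-! Write U_n for `dualVec` at n, a vector of E*_{n+2}W. By bipartiteness A splits into a part
raising and a part lowering the distance from x. Raising sends U_n to c_{n+1}U_{n+1}
(`raise_dualVec`). What remains is to find δ_n = `diagCoeff` and ℓ_n = `lowerCoeff` such that
E*_{n+2}A_{n+2}v = (δ_n - 1)U_n and lowering sends U_{n+1} to ℓ_n U_n.

The spectrum is symmetric about 0 and has D + 1 elements, an odd number, so θ_d = 0, the local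
eigenvalue is b_3 - 1 and δ_0 = b_3 (`theta_half_diam`). Endpoint 2 forces the entries of v to sum
to 0, whence E*_{n+2}(A_n + A_{n+2} + A_{n+4})v = 0 (`dualOp_distOp_add_add`). Thinness makes
E*_{n+2}A_{n+2}v a multiple of U_n as long as U_n is nonzero. Evaluating projections of A A_j v in
two ways then yields recurrences for δ and ℓ, solved by the closed forms in the P_i(0); the
induction is `dualVec_ne_zero_and`.

The recurrence of the p_i shows that P_i(0) is nonzero for i < D, while P_D(0) = 0 because b_D = 0.
Hence ℓ_n is nonzero for n < D - 3 and ℓ_{D-3} = 0. Raising and lowering are adjoint, so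
c_{n+1}‖U_{n+1}‖² = ℓ_n‖U_n‖² (`cNum_mul_norm_sq_dualVec`): this gives the norms, the nonvanishing
up to D - 3 and U_{D-2} = 0. The span of the U_n is therefore a nonzero submodule, equal to W by
irreducibility. Finally p_{n+2}(A)v = U_{n+2} + δ_n U_n (`toEuclideanLin_aeval_pPoly_eq`), and
unwinding this two-term relation expresses U_i through the p_h(A)v. -/

theorem Connected.dist_le_diam_of_fintype (hΓ : Γ.Connected) (x y : X) :
    Γ.dist x y ≤ Γ.diam := by
  have := hΓ.nonempty
  exact SimpleGraph.dist_le_diam (connected_iff_ediam_ne_top.mp hΓ)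

theorem Connected.exists_adj_dist_eq (hΓ : Γ.Connected) {x y : X} {n : ℕ}
    (h : Γ.dist x y = n + 1) : ∃ z, Γ.dist y z = 1 ∧ Γ.dist x z = n := by
  obtain ⟨p, hp⟩ := hΓ.exists_walk_length_eq_dist y x
  rw [dist_comm, h] at hp
  cases p with
  | nil => simp at hp
  | @cons _ z _ hadj q =>
    have h1 : Γ.dist y z = 1 := dist_eq_one_iff_adj.mpr hadj
    have h2 := dist_le q
    have h3 : Γ.dist x y ≤ Γ.dist x z + Γ.dist z y := hΓ.dist_triangle
    rw [Walk.length_cons] at hp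
    rw [dist_comm (u := z) (v := y)] at h3
    rw [dist_comm (u := z) (v := x)] at h2
    exact ⟨z, h1, by omega⟩

theorem Connected.exists_dist_eq (hΓ : Γ.Connected) {n : ℕ} (hn : n ≤ Γ.diam) :
    ∃ x y : X, Γ.dist x y = n := by
  have := hΓ.nonempty
  obtain ⟨x, y, hxy⟩ := Γ.exists_dist_eq_diam
  refine ⟨x, ?_⟩
  induction hn using Nat.decreasingInduction with
  | self => exact ⟨y, hxy⟩
  | of_succ n _ ih =>
    obtain ⟨z, hz⟩ := ih
    obtain ⟨w, -, hw⟩ := hΓ.exists_adj_dist_eq hz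
    exact ⟨w, hw⟩

theorem Connected.even_dist_iff (hΓ : Γ.Connected) (c : Γ.Coloring Bool) (x y : X) :
    Even (Γ.dist x y) ↔ (c x ↔ c y) := by
  obtain ⟨p, hp⟩ := hΓ.exists_walk_length_eq_dist x y
  rw [← hp]
  exact c.even_length_iff_congr p

theorem IsBipartite.nonempty_coloring_bool (hb : Γ.IsBipartite) : Nonempty (Γ.Coloring Bool) :=
  ⟨hb.toColoring (by simp)⟩

theorem IsBipartite.even_dist_add (hb : Γ.IsBipartite) (hΓ : Γ.Connected) (x y z : X) :
    Even (Γ.dist x y + Γ.dist y z + Γ.dist x z) := by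
  obtain ⟨c⟩ := hb.nonempty_coloring_bool
  simp only [Nat.even_add, hΓ.even_dist_iff c]
  tauto

end Distance

/-! ### Intersection numbers -/

section IntersectionNumbers

variable {Γ : SimpleGraph X}

theorem distCount_eq_zero {i j : ℕ} {x y : X}
    (h : ∀ z, Γ.dist x z = i → Γ.dist z y ≠ j) : Γ.distCount i j x y = 0 := by
  rw [distCount, Finset.card_eq_zero, Finset.filter_eq_empty_iff]
  rintro z - ⟨h1, h2⟩
  exact h z h1 h2

theorem distCount_pos {i j : ℕ} {x y z : X} (h1 : Γ.dist x z = i) (h2 : Γ.dist z y = j) :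
    0 < Γ.distCount i j x y :=
  Finset.card_pos.mpr ⟨z, by simp [h1, h2]⟩

theorem intersectionNumber_eq_zero (hΓ : Γ.Connected) {h i j : ℕ} (hj : Γ.diam < j) :
    Γ.intersectionNumber h i j = 0 := by
  rw [intersectionNumber]
  split_ifs with H
  · exact distCount_eq_zero fun z _ h2 =>
      absurd (hΓ.dist_le_diam_of_fintype z H.choose.2) (by omega)
  · rfl

namespace IsDistanceRegular

theorem bNum_eq (hΓ : Γ.IsDistanceRegular) (hD : 1 ≤ Γ.diam) {x y : X} {i : ℕ}
    (h : Γ.dist x y = i) : Γ.bNum i = Γ.distCount 1 (i + 1) x y := by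
  have hi : i ≤ Γ.diam := h ▸ hΓ.connected.dist_le_diam_of_fintype x y
  rcases hi.lt_or_eq with hi' | hi'
  · rw [bNum, hΓ.distCount_eq_intersectionNumber hi hD hi' h]
  -- The regularity axiom only covers indices up to D, so index D + 1 is treated apart; both sides
  -- are 0.
  · rw [bNum, intersectionNumber_eq_zero hΓ.connected (by omega), distCount_eq_zero]
    intro z _ h2
    have := hΓ.connected.dist_le_diam_of_fintype z y
    omega

theorem cNum_succ_eq (hΓ : Γ.IsDistanceRegular) {x y : X} {i : ℕ}
    (h : Γ.dist x y = i + 1) : Γ.cNum (i + 1) = Γ.distCount 1 i x y := by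
  have hi : i + 1 ≤ Γ.diam := h ▸ hΓ.connected.dist_le_diam_of_fintype x y
  rw [cNum, hΓ.distCount_eq_intersectionNumber hi (by omega) (by omega) h]

theorem kNum_eq (hΓ : Γ.IsDistanceRegular) (x : X) {i : ℕ} (hi : i ≤ Γ.diam) :
    Γ.kNum i = (Finset.univ.filter fun z => Γ.dist x z = i).card := by
  rw [kNum, ← hΓ.distCount_eq_intersectionNumber (Nat.zero_le _) hi hi (dist_self (v := x)),
    distCount]
  congr 3
  ext z
  rw [dist_comm (u := z)]
  simp

theorem bNum_diam (hΓ : Γ.IsDistanceRegular) : Γ.bNum Γ.diam = 0 := by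
  rw [bNum, intersectionNumber_eq_zero hΓ.connected (by omega), Nat.cast_zero]

theorem bNum_pos (hΓ : Γ.IsDistanceRegular) {i : ℕ} (hi : i < Γ.diam) : 0 < Γ.bNum i := by
  obtain ⟨x, y, hxy⟩ := hΓ.connected.exists_dist_eq (Nat.succ_le_of_lt hi)
  obtain ⟨z, h1, h2⟩ := hΓ.connected.exists_adj_dist_eq hxy
  rw [hΓ.bNum_eq (by omega) (dist_comm.trans h2)]
  exact_mod_cast distCount_pos (dist_comm.trans h1) (dist_comm.trans hxy)

theorem cNum_pos (hΓ : Γ.IsDistanceRegular) {i : ℕ} (h0 : 1 ≤ i) (hi : i ≤ Γ.diam) :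
    0 < Γ.cNum i := by
  obtain ⟨i, rfl⟩ := Nat.exists_eq_add_of_le' h0
  obtain ⟨x, y, hxy⟩ := hΓ.connected.exists_dist_eq hi
  obtain ⟨z, h1, h2⟩ := hΓ.connected.exists_adj_dist_eq hxy
  rw [hΓ.cNum_succ_eq (dist_comm.trans hxy)]
  exact_mod_cast distCount_pos h1 (dist_comm.trans h2)

theorem cNum_one (hΓ : Γ.IsDistanceRegular) (hD : 1 ≤ Γ.diam) : Γ.cNum 1 = 1 := by
  obtain ⟨x, y, hxy⟩ := hΓ.connected.exists_dist_eq hD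
  rw [hΓ.cNum_succ_eq hxy, distCount]
  norm_cast
  rw [Finset.card_eq_one]
  refine ⟨y, ?_⟩
  ext z
  rw [Finset.mem_filter, Finset.mem_singleton, hΓ.connected.dist_eq_zero_iff]
  constructor
  · exact fun h => h.2.2
  · rintro rfl
    exact ⟨Finset.mem_univ _, hxy, rfl⟩

theorem kNum_pos (hΓ : Γ.IsDistanceRegular) {i : ℕ} (hi : i ≤ Γ.diam) : 0 < Γ.kNum i := by
  obtain ⟨x, y, hxy⟩ := hΓ.connected.exists_dist_eq hi
  rw [hΓ.kNum_eq x hi]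
  exact_mod_cast Finset.card_pos.mpr ⟨y, by simp [hxy]⟩

theorem kNum_zero (hΓ : Γ.IsDistanceRegular) : Γ.kNum 0 = 1 := by
  obtain ⟨x⟩ := hΓ.connected.nonempty
  rw [hΓ.kNum_eq x (Nat.zero_le _)]
  norm_cast
  rw [Finset.card_eq_one]
  refine ⟨x, ?_⟩
  ext z
  simp [hΓ.connected.dist_eq_zero_iff, eq_comm]

theorem bNum_zero (hΓ : Γ.IsDistanceRegular) (hD : 1 ≤ Γ.diam) : Γ.bNum 0 = Γ.kNum 1 := by
  obtain ⟨x⟩ := hΓ.connected.nonempty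
  rw [hΓ.kNum_eq x hD, hΓ.bNum_eq hD (dist_self (v := x)), distCount]
  congr 3
  ext z
  rw [dist_comm (u := z)]
  simp

/-- By parity no neighbour of x is as far from y as x is. The constancy of b_i + c_i is what turns
the recurrence of the f_i into one for the p_i. -/
theorem bNum_add_cNum (hΓ : Γ.IsDistanceRegular) (hb : Γ.IsBipartite) (hD : 1 ≤ Γ.diam) {i : ℕ}
    (hi : i ≤ Γ.diam) : Γ.bNum i + Γ.cNum i = Γ.kNum 1 := by
  cases i with
  | zero => rw [hΓ.bNum_zero hD, cNum, add_zero]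
  | succ i =>
    obtain ⟨x, y, hxy⟩ := hΓ.connected.exists_dist_eq hi
    rw [hΓ.cNum_succ_eq hxy, hΓ.bNum_eq hD hxy, hΓ.kNum_eq x hD, distCount, distCount]
    norm_cast
    rw [← Finset.card_union_of_disjoint]
    · congr 1
      ext z
      simp only [Finset.mem_union, Finset.mem_filter, Finset.mem_univ, true_and]
      constructor
      · rintro (h | h) <;> exact h.1
      · intro h
        have h1 := hb.even_dist_add hΓ.connected x z y
        have h2 : Γ.dist x y ≤ Γ.dist x z + Γ.dist z y := hΓ.connected.dist_triangle
        have h3 : Γ.dist z y ≤ Γ.dist z x + Γ.dist x y := hΓ.connected.dist_triangle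
        rw [dist_comm (u := z) (v := x)] at h3
        rw [Nat.even_iff] at h1
        omega
    · rw [Finset.disjoint_filter]
      intro z _ h1 h2
      omega

end IsDistanceRegular

end IntersectionNumbers

/-! ### Distance matrices -/

section DistMatrix

variable {Γ : SimpleGraph X}

theorem distMatrix_zero (hΓ : Γ.Connected) (R : Type*) [Zero R] [One R] :
    Γ.distMatrix R 0 = 1 := by
  ext y z
  simp [distMatrix, Matrix.one_apply, hΓ.dist_eq_zero_iff]

theorem distMatrix_eq_zero (hΓ : Γ.Connected) (R : Type*) [Zero R] [One R] {i : ℕ}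
    (hi : Γ.diam < i) : Γ.distMatrix R i = 0 := by
  ext y z
  have := hΓ.dist_le_diam_of_fintype y z
  simp [distMatrix, show Γ.dist y z ≠ i by omega]

theorem distMatrix_one_mul_apply (R : Type*) [Semiring R] (i : ℕ) (y z : X) :
    (Γ.distMatrix R 1 * Γ.distMatrix R i) y z = (Γ.distCount 1 i y z : R) := by
  simp only [Matrix.mul_apply, distMatrix, Matrix.of_apply, distCount, mul_ite, mul_one, mul_zero,
    Finset.card_filter, Nat.cast_sum]
  refine Finset.sum_congr rfl fun w _ => ?_
  split_ifs <;> simp_all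

/-- Parity excludes a term in A_{i+1}. The index is unbounded: at i = D - 1 the last term vanishes.
The ring R is ℝ for the spectrum and ℂ for the module. -/
theorem IsDistanceRegular.distMatrix_one_mul (hΓ : Γ.IsDistanceRegular) (hb : Γ.IsBipartite)
    (hD : 1 ≤ Γ.diam) (R : Type*) [Ring R] [Algebra ℝ R] (i : ℕ) :
    Γ.distMatrix R 1 * Γ.distMatrix R (i + 1) =
      Γ.bNum i • Γ.distMatrix R i + Γ.cNum (i + 2) • Γ.distMatrix R (i + 2) := by
  ext y z
  rw [distMatrix_one_mul_apply]
  have hcast : ∀ n : ℕ, (n : ℝ) • (1 : R) = (n : R) := fun n => by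
    rw [← Algebra.algebraMap_eq_smul_one, map_natCast]
  simp only [Matrix.add_apply, Matrix.smul_apply, distMatrix, Matrix.of_apply]
  by_cases h1 : Γ.dist y z = i
  · simp [h1, hΓ.bNum_eq hD h1, hcast]
  by_cases h2 : Γ.dist y z = i + 2
  · simp [h2, hΓ.cNum_succ_eq h2, hcast]
  rw [if_neg h1, if_neg h2, distCount_eq_zero]
  · simp
  · intro w h3 h4
    have h5 := hb.even_dist_add hΓ.connected y w z
    have h6 : Γ.dist y z ≤ Γ.dist y w + Γ.dist w z := hΓ.connected.dist_triangle
    have h7 : Γ.dist w z ≤ Γ.dist w y + Γ.dist y z := hΓ.connected.dist_triangle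
    rw [dist_comm (u := w) (v := y)] at h7
    rw [Nat.even_iff] at h5
    omega

theorem IsDistanceRegular.distMatrix_mulVec_one (hΓ : Γ.IsDistanceRegular) {i : ℕ}
    (hi : i ≤ Γ.diam) : (Γ.distMatrix ℝ i).mulVec 1 = fun _ => Γ.kNum i := by
  ext y
  rw [hΓ.kNum_eq y hi]
  simp [Matrix.mulVec, dotProduct, distMatrix]

/-- `k_i b_i = k_{i+1} c_{i+1}`. -/
theorem IsDistanceRegular.kNum_mul_bNum (hΓ : Γ.IsDistanceRegular) (hb : Γ.IsBipartite) {i : ℕ}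
    (hi : i + 1 ≤ Γ.diam) :
    Γ.kNum i * Γ.bNum i = Γ.kNum (i + 1) * Γ.cNum (i + 1) := by
  have hD : 1 ≤ Γ.diam := by omega
  induction i with
  | zero => rw [hΓ.kNum_zero, hΓ.bNum_zero hD, hΓ.cNum_one hD, one_mul, mul_one]
  | succ i ih =>
    have ih := ih (by omega)
    obtain ⟨x⟩ := hΓ.connected.nonempty
    -- Applied to the all-ones vector, the product relation reads k k_{i+1} = b_i k_i + c_{i+2}
    -- k_{i+2}. Putting k = b_{i+1} + c_{i+1} and using the induction hypothesis leaves the claim.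
    have h := congrFun (congrArg (fun M => Matrix.mulVec M (1 : X → ℝ))
      (hΓ.distMatrix_one_mul hb hD ℝ i)) x
    simp only [← Matrix.mulVec_mulVec, Matrix.add_mulVec, Matrix.smul_mulVec,
      hΓ.distMatrix_mulVec_one (show i + 1 ≤ Γ.diam by omega),
      hΓ.distMatrix_mulVec_one (show i ≤ Γ.diam by omega),
      hΓ.distMatrix_mulVec_one hi] at h
    have h' : (fun _ : X => Γ.kNum (i + 1)) = Γ.kNum (i + 1) • (1 : X → ℝ) := by
      ext; simp
    rw [h', Matrix.mulVec_smul, hΓ.distMatrix_mulVec_one hD] at h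
    simp only [Pi.smul_apply, Pi.add_apply, smul_eq_mul] at h
    rw [← hΓ.bNum_add_cNum hb hD (show i + 1 ≤ Γ.diam by omega)] at h
    linarith

end DistMatrix

/-! ### The polynomials -/

section Polynomials

open Polynomial

variable {Γ : SimpleGraph X}

theorem IsDistanceRegular.aeval_fPoly (hΓ : Γ.IsDistanceRegular) (hb : Γ.IsBipartite)
    (hD : 1 ≤ Γ.diam) (R : Type*) [Ring R] [Algebra ℝ R] :
    ∀ i ≤ Γ.diam, aeval (Γ.distMatrix R 1) (Γ.fPoly i) = Γ.distMatrix R i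
  | 0, _ => by rw [fPoly, map_one, distMatrix_zero hΓ.connected]
  | 1, _ => by rw [fPoly, hΓ.cNum_one hD]; simp
  | i + 2, hi => by
    have h := hΓ.distMatrix_one_mul hb hD R i
    have hc := (hΓ.cNum_pos (Nat.le_add_left 1 (i + 1)) hi).ne'
    rw [fPoly, ← Polynomial.smul_eq_C_mul, map_smul, map_sub, map_mul, aeval_X,
      aeval_fPoly hΓ hb hD R (i + 1) (by omega), ← Polynomial.smul_eq_C_mul, map_smul,
      aeval_fPoly hΓ hb hD R i (by omega), h, add_sub_cancel_left, smul_smul,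
      inv_mul_cancel₀ hc, one_smul]

theorem pPoly_zero (Γ : SimpleGraph X) : Γ.pPoly 0 = 1 := by
  simp [pPoly, Finset.filter_singleton, fPoly]

theorem pPoly_one (Γ : SimpleGraph X) : Γ.pPoly 1 = Γ.fPoly 1 := by
  simp [pPoly, Finset.sum_filter, Finset.sum_range_succ]

theorem sum_range_filter_mod_two_add_two {M : Type*} [AddCommMonoid M] (i : ℕ) (F : ℕ → M) :
    ∑ j ∈ Finset.range (i + 2 + 1) with j % 2 = (i + 2) % 2, F j =
      F (i + 2) + ∑ j ∈ Finset.range (i + 1) with j % 2 = i % 2, F j := by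
  simp only [Finset.sum_filter]
  rw [Finset.sum_range_succ, Finset.sum_range_succ, if_pos rfl,
    if_neg (show (i + 1) % 2 ≠ (i + 2) % 2 by omega), add_zero, add_comm]
  simp

theorem pPoly_add_two (Γ : SimpleGraph X) (i : ℕ) :
    Γ.pPoly (i + 2) = Γ.fPoly (i + 2) + Γ.pPoly i :=
  sum_range_filter_mod_two_add_two i _

theorem IsDistanceRegular.cNum_mul_fPoly (hΓ : Γ.IsDistanceRegular) {i : ℕ}
    (hi : i + 2 ≤ Γ.diam) : C (Γ.cNum (i + 2)) * Γ.fPoly (i + 2) =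
      Polynomial.X * Γ.fPoly (i + 1) - C (Γ.bNum i) * Γ.fPoly i := by
  have hc := (hΓ.cNum_pos (Nat.le_add_left 1 (i + 1)) hi).ne'
  rw [fPoly, ← mul_assoc, ← C_mul, mul_inv_cancel₀ hc, C_1, one_mul]

/-- `λ p_{i+1} = c_{i+2} p_{i+2} + b_{i+2} p_i`. -/
theorem IsDistanceRegular.X_mul_pPoly (hΓ : Γ.IsDistanceRegular) (hb : Γ.IsBipartite) :
    ∀ {i : ℕ}, i + 2 ≤ Γ.diam → Polynomial.X * Γ.pPoly (i + 1) =
      C (Γ.cNum (i + 2)) * Γ.pPoly (i + 2) + C (Γ.bNum (i + 2)) * Γ.pPoly i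
  | 0, hi => by
    have h := hΓ.cNum_mul_fPoly hi
    have hk : Γ.bNum 2 + Γ.cNum 2 = Γ.bNum 0 := by
      rw [hΓ.bNum_add_cNum hb (by omega) hi, hΓ.bNum_zero (by omega)]
    rw [pPoly_add_two, pPoly_zero, pPoly_one]
    rw [← hk, C_add, fPoly.eq_1] at h
    linear_combination -h
  | 1, hi => by
    have h := hΓ.cNum_mul_fPoly hi
    have hk : Γ.bNum 3 + Γ.cNum 3 = Γ.bNum 1 + Γ.cNum 1 := by
      rw [hΓ.bNum_add_cNum hb (by omega) hi, hΓ.bNum_add_cNum hb (by omega) (by omega)]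
    have hk' := congrArg (C : ℝ → ℝ[X]) hk
    have h1 : C (Γ.cNum 1) * Γ.fPoly 1 = Polynomial.X := by
      rw [fPoly, hΓ.cNum_one (by omega)]; simp
    rw [pPoly_add_two, pPoly_zero, pPoly_add_two, pPoly_one]
    simp only [C_add] at hk'
    linear_combination -h - Γ.fPoly 1 * hk' - h1
  | i + 2, hi => by
    -- Adding the relation for λ f_{i+3} to the one for λ p_{i+1} merges b_{i+2} f_{i+2} and b_{i+2}
    -- p_i into b_{i+2} p_{i+2}; then b_{i+2} + c_{i+2} = b_{i+4} + c_{i+4}.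
    have h := hΓ.cNum_mul_fPoly hi
    have ih := X_mul_pPoly hΓ hb (i := i) (by omega)
    have hk : Γ.bNum (i + 2 + 2) + Γ.cNum (i + 2 + 2) = Γ.bNum (i + 2) + Γ.cNum (i + 2) := by
      rw [hΓ.bNum_add_cNum hb (by omega) hi, hΓ.bNum_add_cNum hb (by omega) (by omega)]
    have hk' := congrArg (C : ℝ → ℝ[X]) hk
    rw [pPoly_add_two Γ (i + 2), pPoly_add_two Γ (i + 1)]
    simp only [C_add] at hk'
    have e := pPoly_add_two Γ i
    linear_combination -h - Γ.pPoly (i + 2) * hk' + ih - C (Γ.bNum (i + 2)) * e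

end Polynomials

/-! ### The values `P_i(0)` -/

section EvalZero

variable {Γ : SimpleGraph X}

theorem PPoly_eval_zero_of_even {i : ℕ} (hi : Even i) :
    (Γ.PPoly i).eval 0 = (Γ.pPoly i).coeff 0 := by
  rw [← Polynomial.coeff_zero_eq_eval_zero, PPoly, if_pos hi,
    Polynomial.coeff_contract two_ne_zero, zero_mul]

theorem PPoly_eval_zero_of_odd {i : ℕ} (hi : Odd i) :
    (Γ.PPoly i).eval 0 = (Γ.pPoly i).coeff 1 := by
  rw [← Polynomial.coeff_zero_eq_eval_zero, PPoly, if_neg (Nat.not_even_iff_odd.mpr hi),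
    Polynomial.coeff_contract two_ne_zero, zero_mul, Polynomial.coeff_divX]

theorem PPoly_zero_eval_zero (Γ : SimpleGraph X) : (Γ.PPoly 0).eval 0 = 1 := by
  rw [PPoly_eval_zero_of_even Even.zero, pPoly_zero, Polynomial.coeff_one_zero]

namespace IsDistanceRegular

theorem PPoly_one_eval_zero (hΓ : Γ.IsDistanceRegular) (hD : 1 ≤ Γ.diam) :
    (Γ.PPoly 1).eval 0 = 1 := by
  rw [PPoly_eval_zero_of_odd odd_one, pPoly_one, fPoly, hΓ.cNum_one hD]
  simp

/-- P_i(0) is the coefficient of 1 or λ in p_i, according to parity. In the recurrence of the p_i,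
the product λ p_{i+1} contributes nothing to the constant coefficient, but contributes P_{i+1}(0) to
the coefficient of λ in the odd case. -/
theorem cNum_mul_PPoly_of_even (hΓ : Γ.IsDistanceRegular) (hb : Γ.IsBipartite) {i : ℕ}
    (hi : i + 2 ≤ Γ.diam) (he : Even i) :
    Γ.cNum (i + 2) * (Γ.PPoly (i + 2)).eval 0 = -(Γ.bNum (i + 2) * (Γ.PPoly i).eval 0) := by
  have h := congrArg (fun p => Polynomial.coeff p 0) (hΓ.X_mul_pPoly hb hi)
  simp only [Polynomial.coeff_X_mul_zero, Polynomial.coeff_add, Polynomial.coeff_C_mul] at h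
  rw [PPoly_eval_zero_of_even he, PPoly_eval_zero_of_even (he.add even_two)]
  linarith

theorem cNum_mul_PPoly_of_odd (hΓ : Γ.IsDistanceRegular) (hb : Γ.IsBipartite) {i : ℕ}
    (hi : i + 2 ≤ Γ.diam) (ho : Odd i) :
    Γ.cNum (i + 2) * (Γ.PPoly (i + 2)).eval 0 =
      (Γ.PPoly (i + 1)).eval 0 - Γ.bNum (i + 2) * (Γ.PPoly i).eval 0 := by
  have h := congrArg (fun p => Polynomial.coeff p 1) (hΓ.X_mul_pPoly hb hi)
  simp only [Polynomial.coeff_X_mul, Polynomial.coeff_add, Polynomial.coeff_C_mul] at h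
  rw [PPoly_eval_zero_of_odd ho, PPoly_eval_zero_of_odd (ho.add_even even_two),
    PPoly_eval_zero_of_even (ho.add_odd odd_one)]
  linarith

/-- For `2 * m + 1 < D` both values at `0`, of index `2 * m` and `2 * m + 1`, have the sign
of `(-1) ^ m`. -/
theorem PPoly_eval_zero_sign (hΓ : Γ.IsDistanceRegular) (hb : Γ.IsBipartite) (m : ℕ)
    (hm : 2 * m + 1 < Γ.diam) :
    0 < (-1) ^ m * (Γ.PPoly (2 * m)).eval 0 ∧ 0 < (-1) ^ m * (Γ.PPoly (2 * m + 1)).eval 0 := by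
  induction m with
  | zero => simp [PPoly_zero_eval_zero, hΓ.PPoly_one_eval_zero (by omega)]
  | succ m ih =>
    obtain ⟨h0, h1⟩ := ih (by omega)
    have e0 := hΓ.cNum_mul_PPoly_of_even hb (i := 2 * m) (by omega) (even_two_mul m)
    have e1 := hΓ.cNum_mul_PPoly_of_odd hb (i := 2 * m + 1) (by omega) (odd_two_mul_add_one m)
    have c0 := hΓ.cNum_pos (i := 2 * m + 2) (by omega) (by omega)
    have c1 := hΓ.cNum_pos (i := 2 * m + 1 + 2) (by omega) (by omega)
    have b0 := hΓ.bNum_pos (i := 2 * m + 2) (by omega)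
    have b1 := hΓ.bNum_pos (i := 2 * m + 1 + 2) (by omega)
    have p0 : 0 < (-1) ^ (m + 1) * (Γ.PPoly (2 * m + 2)).eval 0 := by
      refine pos_of_mul_pos_right ?_ c0.le
      have : Γ.cNum (2 * m + 2) * ((-1) ^ (m + 1) * (Γ.PPoly (2 * m + 2)).eval 0) =
          Γ.bNum (2 * m + 2) * ((-1) ^ m * (Γ.PPoly (2 * m)).eval 0) := by
        rw [pow_succ]; linear_combination (-(-1) ^ m) * e0
      rw [this]
      exact mul_pos b0 h0
    refine ⟨p0, ?_⟩
    refine pos_of_mul_pos_right ?_ c1.le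
    have : Γ.cNum (2 * m + 1 + 2) * ((-1) ^ (m + 1) * (Γ.PPoly (2 * m + 1 + 2)).eval 0) =
        (-1) ^ (m + 1) * (Γ.PPoly (2 * m + 2)).eval 0 +
          Γ.bNum (2 * m + 1 + 2) * ((-1) ^ m * (Γ.PPoly (2 * m + 1)).eval 0) := by
      have e1' : Γ.cNum (2 * m + 1 + 2) * (Γ.PPoly (2 * m + 1 + 2)).eval 0 =
          (Γ.PPoly (2 * m + 2)).eval 0 - Γ.bNum (2 * m + 1 + 2) * (Γ.PPoly (2 * m + 1)).eval 0 :=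
        e1
      rw [pow_succ]; linear_combination (-(-1) ^ m) * e1'
    rw [show 2 * (m + 1) + 1 = 2 * m + 1 + 2 by ring, this]
    exact add_pos p0 (mul_pos b1 h1)

theorem PPoly_eval_zero_ne_zero (hΓ : Γ.IsDistanceRegular) (hb : Γ.IsBipartite)
    (hD : Even Γ.diam) {i : ℕ} (hi : i < Γ.diam) : (Γ.PPoly i).eval 0 ≠ 0 := by
  have hm : 2 * (i / 2) + 1 < Γ.diam := by
    rw [Nat.even_iff] at hD
    omega
  obtain ⟨h0, h1⟩ := hΓ.PPoly_eval_zero_sign hb (i / 2) hm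
  rcases Nat.mod_two_eq_zero_or_one i with h | h
  · rw [show 2 * (i / 2) = i by omega] at h0
    exact right_ne_zero_of_mul h0.ne'
  · rw [show 2 * (i / 2) + 1 = i by omega] at h1
    exact right_ne_zero_of_mul h1.ne'

/-- The even recurrence meets b_D = 0. This zero is what ends the chain of basis vectors. -/
theorem PPoly_diam_eval_zero (hΓ : Γ.IsDistanceRegular) (hb : Γ.IsBipartite)
    (hD : Even Γ.diam) (hD2 : 2 ≤ Γ.diam) : (Γ.PPoly Γ.diam).eval 0 = 0 := by
  obtain ⟨n, hn⟩ := Nat.exists_eq_add_of_le' hD2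
  have h := hΓ.cNum_mul_PPoly_of_even hb (i := n) (by omega)
    (by rw [Nat.even_iff] at hD ⊢; omega)
  rw [← hn, hΓ.bNum_diam, zero_mul, neg_zero] at h
  exact (mul_eq_zero.mp h).resolve_left (hΓ.cNum_pos (by omega) le_rfl).ne'

end IsDistanceRegular

end EvalZero

/-! ### The scalars that describe the module -/

noncomputable section

/-- `E*_{i+2} (A_{i+2} + A_i)` acts on `E*_2 W` as `diagCoeff i` times `E*_{i+2} A_i`. -/
def diagCoeff (Γ : SimpleGraph X) (i : ℕ) : ℝ :=
  -(Γ.bNum (i + 2) * Γ.bNum (i + 3) * (Γ.PPoly i).eval 0) /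
    (Γ.cNum (i + 1) * Γ.cNum (i + 2) * (Γ.PPoly (i + 2)).eval 0)

/-- The factor by which lowering sends `E*_{i+3} A_{i+1} v` to `E*_{i+2} A_i v`. -/
def lowerCoeff (Γ : SimpleGraph X) (i : ℕ) : ℝ :=
  (Γ.bNum (i + 2) * Γ.cNum (i + 3) * (Γ.PPoly (i + 3)).eval 0 * (Γ.PPoly i).eval 0) /
    (Γ.cNum (i + 1) * (Γ.PPoly (i + 1)).eval 0 * (Γ.PPoly (i + 2)).eval 0)

end

/-! ### Recurrences satisfied by the two families of scalars -/

namespace IsDistanceRegular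

variable {Γ : SimpleGraph X}

theorem diagCoeff_of_even (hΓ : Γ.IsDistanceRegular) (hb : Γ.IsBipartite) (hD : Even Γ.diam)
    {i : ℕ} (hi : i + 2 < Γ.diam) (he : Even i) :
    Γ.diagCoeff i = Γ.bNum (i + 3) / Γ.cNum (i + 1) := by
  have e := hΓ.cNum_mul_PPoly_of_even hb hi.le he
  have hc1 := (hΓ.cNum_pos (i := i + 1) (by omega) (by omega)).ne'
  have hb2 := (hΓ.bNum_pos hi).ne'
  have hq := hΓ.PPoly_eval_zero_ne_zero hb hD (i := i) (by omega)
  rw [diagCoeff, mul_assoc (Γ.cNum (i + 1)), e]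
  field_simp

theorem diagCoeff_zero (hΓ : Γ.IsDistanceRegular) (hb : Γ.IsBipartite) (hD : Even Γ.diam)
    (hD2 : 2 < Γ.diam) : Γ.diagCoeff 0 = Γ.bNum 3 := by
  rw [hΓ.diagCoeff_of_even hb hD hD2 Even.zero, hΓ.cNum_one (by omega), div_one]

theorem lowerCoeff_zero (hΓ : Γ.IsDistanceRegular) (hb : Γ.IsBipartite) (hD : Even Γ.diam)
    (hD3 : 3 ≤ Γ.diam) : Γ.lowerCoeff 0 = Γ.bNum 2 + Γ.cNum 2 * Γ.diagCoeff 0 := by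
  have e := hΓ.cNum_mul_PPoly_of_even hb (i := 0) (by omega) Even.zero
  have o := hΓ.cNum_mul_PPoly_of_odd hb (i := 1) (by omega) odd_one
  simp only [zero_add, Nat.reduceAdd, PPoly_zero_eval_zero,
    hΓ.PPoly_one_eval_zero (show 1 ≤ Γ.diam by omega)] at e o
  have hq := hΓ.PPoly_eval_zero_ne_zero hb hD (i := 2) (by omega)
  rw [hΓ.diagCoeff_zero hb hD (by omega), lowerCoeff]
  simp only [zero_add, PPoly_zero_eval_zero, hΓ.cNum_one (show 1 ≤ Γ.diam by omega),
    hΓ.PPoly_one_eval_zero (show 1 ≤ Γ.diam by omega)]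
  field_simp
  linear_combination Γ.bNum 2 * o - Γ.bNum 3 * e

/-- The relation that projecting A A_{i+2} v to distance i + 3 demands. At i + 4 = D the vanishing
value P_D(0) occurs only in a numerator. -/
theorem lowerCoeff_succ (hΓ : Γ.IsDistanceRegular) (hb : Γ.IsBipartite) (hD : Even Γ.diam)
    {i : ℕ} (hi : i + 4 ≤ Γ.diam) :
    Γ.lowerCoeff (i + 1) =
      Γ.bNum (i + 3) + Γ.cNum (i + 3) * Γ.diagCoeff (i + 1) - Γ.cNum (i + 1) * Γ.diagCoeff i := by
  have hc1 := (hΓ.cNum_pos (i := i + 1) (by omega) (by omega)).ne'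
  have hc2 := (hΓ.cNum_pos (i := i + 2) (by omega) (by omega)).ne'
  have hc3 := (hΓ.cNum_pos (i := i + 3) (by omega) (by omega)).ne'
  have hb3 := (hΓ.bNum_pos (i := i + 3) (by omega)).ne'
  have hq0 := hΓ.PPoly_eval_zero_ne_zero hb hD (i := i) (by omega)
  have hq1 := hΓ.PPoly_eval_zero_ne_zero hb hD (i := i + 1) (by omega)
  have hq2 := hΓ.PPoly_eval_zero_ne_zero hb hD (i := i + 2) (by omega)
  have hq3 := hΓ.PPoly_eval_zero_ne_zero hb hD (i := i + 3) (by omega)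
  rcases Nat.even_or_odd i with he | ho
  · have e := hΓ.cNum_mul_PPoly_of_even hb (i := i + 2) (by omega) (he.add even_two)
    rw [hΓ.diagCoeff_of_even hb hD (by omega) he, diagCoeff, lowerCoeff]
    simp only [add_assoc, Nat.reduceAdd] at e ⊢
    field_simp
    linear_combination (Γ.PPoly (i + 1)).eval 0 * e
  · have o := hΓ.cNum_mul_PPoly_of_odd hb (i := i) (by omega) ho
    have e := hΓ.cNum_mul_PPoly_of_even hb (i := i + 1) (by omega) (ho.add_odd odd_one)
    have o' := hΓ.cNum_mul_PPoly_of_odd hb (i := i + 2) (by omega) (ho.add_even even_two)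
    rw [hΓ.diagCoeff_of_even hb hD (by omega) (ho.add_odd odd_one), diagCoeff, lowerCoeff]
    simp only [add_assoc, Nat.reduceAdd] at e o o' ⊢
    field_simp
    linear_combination Γ.bNum (i + 3) * (Γ.PPoly (i + 1)).eval 0 * o' -
      (Γ.PPoly (i + 3)).eval 0 * Γ.bNum (i + 3) * o -
      Γ.bNum (i + 4) * (Γ.PPoly (i + 2)).eval 0 * e

/-- The relation that projecting A A_{i+5} v to distance i + 2 demands. Since ℓ_i is nonzero in this
range, it determines δ_{i+1} from δ_i. -/
theorem diagCoeff_succ_mul_lowerCoeff (hΓ : Γ.IsDistanceRegular) (hb : Γ.IsBipartite)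
    (hD : Even Γ.diam) {i : ℕ} (hi : i + 3 < Γ.diam) :
    Γ.diagCoeff (i + 1) * Γ.lowerCoeff i = Γ.bNum (i + 4) * Γ.diagCoeff i := by
  have hc1 := (hΓ.cNum_pos (i := i + 1) (by omega) (by omega)).ne'
  have hc2 := (hΓ.cNum_pos (i := i + 2) (by omega) (by omega)).ne'
  have hc3 := (hΓ.cNum_pos (i := i + 3) (by omega) (by omega)).ne'
  have hq1 := hΓ.PPoly_eval_zero_ne_zero hb hD (i := i + 1) (by omega)
  have hq2 := hΓ.PPoly_eval_zero_ne_zero hb hD (i := i + 2) (by omega)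
  have hq3 := hΓ.PPoly_eval_zero_ne_zero hb hD (i := i + 3) (by omega)
  rw [diagCoeff, diagCoeff, lowerCoeff]
  simp only [add_assoc, Nat.reduceAdd]
  field_simp

theorem lowerCoeff_ne_zero (hΓ : Γ.IsDistanceRegular) (hb : Γ.IsBipartite)
    (hD : Even Γ.diam) {i : ℕ} (hi : i + 3 < Γ.diam) : Γ.lowerCoeff i ≠ 0 := by
  have hc1 := (hΓ.cNum_pos (i := i + 1) (by omega) (by omega)).ne'
  have hc3 := (hΓ.cNum_pos (i := i + 3) (by omega) (by omega)).ne'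
  have hb2 := (hΓ.bNum_pos (i := i + 2) (by omega)).ne'
  have hq0 := hΓ.PPoly_eval_zero_ne_zero hb hD (i := i) (by omega)
  have hq1 := hΓ.PPoly_eval_zero_ne_zero hb hD (i := i + 1) (by omega)
  have hq2 := hΓ.PPoly_eval_zero_ne_zero hb hD (i := i + 2) (by omega)
  have hq3 := hΓ.PPoly_eval_zero_ne_zero hb hD hi
  exact div_ne_zero (by simp [*]) (by simp [*])

theorem lowerCoeff_eq_zero (hΓ : Γ.IsDistanceRegular) (hb : Γ.IsBipartite)
    (hD : Even Γ.diam) {i : ℕ} (hi : i + 3 = Γ.diam) : Γ.lowerCoeff i = 0 := by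
  rw [lowerCoeff, hi, hΓ.PPoly_diam_eval_zero hb hD (by omega)]
  simp

end IsDistanceRegular

/-! ### The middle eigenvalue -/

/-- In a set of reals of odd size that is symmetric about `0`, the middle element is `0`. -/
theorem sort_getD_eq_zero_of_neg_mem {s : Finset ℝ} {d : ℕ} (hs : ∀ μ ∈ s, -μ ∈ s)
    (hd : s.card = 2 * d + 1) : (s.sort (· ≥ ·)).getD d 0 = 0 := by
  set l := s.sort (· ≥ ·) with hl
  have hlen : l.length = 2 * d + 1 := by rw [hl, Finset.length_sort, hd]
  have hmem : ∀ a, a ∈ l ↔ a ∈ s := fun a => Finset.mem_sort _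
  have hsort : l.Pairwise (· ≥ ·) := Finset.pairwise_sort s _
  have hnodup : l.Nodup := Finset.sort_nodup s _
  -- Negating and reversing gives a decreasing list with the same entries, hence the same list; d is
  -- the position fixed by the reversal.
  have hrev : (l.map Neg.neg).reverse = l := by
    refine List.Perm.eq_of_pairwise (le := (· ≥ ·)) (fun a b _ _ h1 h2 => le_antisymm h2 h1) ?_ hsort
      ?_
    · rw [List.pairwise_reverse, List.pairwise_map]
      exact hsort.imp fun h => neg_le_neg h
    · rw [List.perm_ext_iff_of_nodup (List.nodup_reverse.mpr (hnodup.map neg_injective)) hnodup]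
      intro a
      simp only [List.mem_reverse, List.mem_map, hmem]
      exact ⟨by rintro ⟨b, hb, rfl⟩; exact hs b hb, fun h => ⟨-a, hs a h, neg_neg a⟩⟩
  have hget : l[d]'(by omega) = -(l[d]'(by omega)) := by
    have h1 : l[d]'(by omega) = ((l.map Neg.neg).reverse)[d]'(by simp [hlen]; omega) := by
      simp only [hrev]
    rw [List.getElem_reverse, List.getElem_map] at h1
    simp only [List.length_map, hlen, show 2 * d + 1 - 1 - d = d by omega] at h1
    exact h1
  rw [List.getD_eq_getElem _ _ (by omega)]
  linarith

section Spectrum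

open Polynomial

variable {Γ : SimpleGraph X}

theorem isHermitian_distMatrix (Γ : SimpleGraph X) (R : Type*) [CommRing R] [StarRing R] (i : ℕ) :
    (Γ.distMatrix R i).IsHermitian := by
  ext y z
  rw [Matrix.conjTranspose_apply, distMatrix, Matrix.of_apply, Matrix.of_apply, dist_comm]
  split_ifs <;> simp

theorem distMatrix_one_eq_adjMatrix [DecidableRel Γ.Adj] (R : Type*) [Zero R] [One R] :
    Γ.distMatrix R 1 = Γ.adjMatrix R := by
  ext y z
  simp [distMatrix, adjMatrix_apply, dist_eq_one_iff_adj]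

theorem distMatrix_one_pow_apply_eq_zero {n : ℕ} {y z : X} (h : n < Γ.dist y z) :
    (Γ.distMatrix ℝ 1 ^ n) y z = 0 := by
  classical
  rw [distMatrix_one_eq_adjMatrix, adjMatrix_pow_apply_eq_card_walk, Nat.cast_eq_zero,
    Fintype.card_eq_zero_iff]
  refine ⟨fun p => ?_⟩
  have := dist_le p.1
  have hp := p.2
  rw [Set.mem_ofPred_eq] at hp
  omega

theorem Connected.distMatrix_one_pow_apply_ne_zero (hΓ : Γ.Connected) (y z : X) :
    (Γ.distMatrix ℝ 1 ^ Γ.dist y z) y z ≠ 0 := by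
  classical
  obtain ⟨p, hp⟩ := hΓ.exists_walk_length_eq_dist y z
  rw [distMatrix_one_eq_adjMatrix, adjMatrix_pow_apply_eq_card_walk, Nat.cast_ne_zero]
  have : Nonempty {p : Γ.Walk y z | p.length = Γ.dist y z} := ⟨⟨p, hp⟩⟩
  exact Fintype.card_ne_zero

/-- If deg q = n ≤ D, take y, z at distance n: the (y, z)-entry of A^j is 0 for j < n and nonzero
for j = n. -/
theorem Connected.diam_lt_natDegree (hΓ : Γ.Connected) {q : ℝ[X]} (hq : q ≠ 0)
    (h : aeval (Γ.distMatrix ℝ 1) q = 0) : Γ.diam < q.natDegree := by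
  by_contra! hle
  obtain ⟨y, z, hyz⟩ := hΓ.exists_dist_eq hle
  have h1 : (aeval (Γ.distMatrix ℝ 1) q) y z = 0 := by rw [h]; rfl
  rw [aeval_eq_sum_range, Matrix.sum_apply, Finset.sum_range_succ, Finset.sum_eq_zero, zero_add,
    Matrix.smul_apply, smul_eq_mul] at h1
  · refine (mul_ne_zero (leadingCoeff_ne_zero.mpr hq) ?_) h1
    rw [← hyz]
    exact hΓ.distMatrix_one_pow_apply_ne_zero y z
  · intro i hi
    rw [Finset.mem_range] at hi
    rw [Matrix.smul_apply, distMatrix_one_pow_apply_eq_zero (by omega), smul_zero]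

theorem mem_spectrum_iff_mem_roots {A : Matrix X X ℝ} {μ : ℝ} :
    μ ∈ spectrum ℝ A ↔ μ ∈ A.charpoly.roots.toFinset := by
  rw [Matrix.mem_spectrum_iff_isRoot_charpoly, Multiset.mem_toFinset,
    mem_roots (Matrix.charpoly_monic A).ne_zero]

/-- Conjugation by the diagonal ±1 matrix of a 2-colouring turns A into -A. -/
theorem IsBipartite.neg_mem_spectrum (hb : Γ.IsBipartite) {μ : ℝ}
    (h : μ ∈ spectrum ℝ (Γ.distMatrix ℝ 1)) : -μ ∈ spectrum ℝ (Γ.distMatrix ℝ 1) := by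
  obtain ⟨c⟩ := hb.nonempty_coloring_bool
  let S : Matrix X X ℝ := Matrix.diagonal fun y => if c y then 1 else -1
  have hS : S * S = 1 := by
    rw [Matrix.diagonal_mul_diagonal, ← Matrix.diagonal_one]
    congr 1
    ext y
    split_ifs <;> simp
  let u : (Matrix X X ℝ)ˣ := ⟨S, S, hS, hS⟩
  have hconj : (u : Matrix X X ℝ) * Γ.distMatrix ℝ 1 * (u⁻¹ : (Matrix X X ℝ)ˣ) = -Γ.distMatrix ℝ 1 := by
    change S * Γ.distMatrix ℝ 1 * S = _
    ext y z
    rw [Matrix.mul_diagonal, Matrix.diagonal_mul, Matrix.neg_apply, distMatrix, Matrix.of_apply]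
    by_cases hyz : Γ.dist y z = 1
    · have hne := c.valid (dist_eq_one_iff_adj.mp hyz)
      cases hy : c y <;> cases hz : c z <;> simp_all
    · simp [hyz]
  rw [← spectrum.units_conjugate (u := u), hconj, ← spectrum.neg_eq, Set.neg_mem_neg]
  exact h

theorem aeval_prod_roots_of_isHermitian {A : Matrix X X ℝ} (hA : A.IsHermitian) :
    aeval A (∏ μ ∈ A.charpoly.roots.toFinset, (Polynomial.X - C μ)) = 0 := by
  set m := ∏ μ ∈ A.charpoly.roots.toFinset, (Polynomial.X - C μ) with hm
  have hroot : ∀ i, m.eval (hA.eigenvalues i) = 0 := fun i => by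
    rw [hm, eval_prod]
    exact Finset.prod_eq_zero (mem_spectrum_iff_mem_roots.mp (hA.eigenvalues_mem_spectrum_real i))
      (by simp)
  have hdiag : aeval (Matrix.diagonal hA.eigenvalues) m = 0 := by
    have h1 : Matrix.diagonal hA.eigenvalues = Matrix.diagonalAlgHom ℝ hA.eigenvalues := rfl
    rw [h1, aeval_algHom_apply]
    have h2 : aeval hA.eigenvalues m = 0 := by
      ext i
      have := aeval_algHom_apply (Pi.evalAlgHom ℝ (fun _ : X => ℝ) i) hA.eigenvalues m
      rw [Pi.zero_apply, ← hroot i, ← coe_aeval_eq_eval]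
      exact this.symm
    rw [h2, map_zero]
  have h := hA.spectral_theorem
  rw [h, aeval_algHom_apply]
  exact (congrArg _ hdiag).trans (map_zero _)

theorem IsDistanceRegular.natDegree_fPoly_le (hΓ : Γ.IsDistanceRegular) :
    ∀ i ≤ Γ.diam, (Γ.fPoly i).natDegree ≤ i ∧ (Γ.fPoly i).coeff i ≠ 0
  | 0, _ => by simp [fPoly]
  | 1, hi => by
    have hc := hΓ.cNum_one hi
    simp [fPoly, hc]
  | i + 2, hi => by
    obtain ⟨h1, h2⟩ := natDegree_fPoly_le hΓ (i + 1) (by omega)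
    obtain ⟨h3, -⟩ := natDegree_fPoly_le hΓ i (by omega)
    have hc := (hΓ.cNum_pos (Nat.le_add_left 1 (i + 1)) hi).ne'
    constructor
    · rw [fPoly]
      refine (natDegree_C_mul_le _ _).trans ((natDegree_sub_le _ _).trans (max_le ?_ ?_))
      · exact natDegree_mul_le.trans (by rw [natDegree_X]; omega)
      · exact (natDegree_C_mul_le _ _).trans (by omega)
    · rw [fPoly, coeff_C_mul, coeff_sub, coeff_C_mul, coeff_X_mul,
        coeff_eq_zero_of_natDegree_lt (p := Γ.fPoly i) (by omega), mul_zero, sub_zero]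
      exact mul_ne_zero (inv_ne_zero hc) h2

/-- A bipartite distance-regular graph of diameter `D` has exactly `D + 1` distinct eigenvalues. -/
theorem IsDistanceRegular.card_roots_charpoly (hΓ : Γ.IsDistanceRegular) (hb : Γ.IsBipartite)
    (hD : 1 ≤ Γ.diam) :
    (Γ.distMatrix ℝ 1).charpoly.roots.toFinset.card = Γ.diam + 1 := by
  have := hΓ.connected.nonempty
  apply le_antisymm
  · obtain ⟨n, hn⟩ := Nat.exists_eq_add_of_le' hD
    obtain ⟨h1, h2⟩ := hΓ.natDegree_fPoly_le (n + 1) (by omega)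
    obtain ⟨h3, -⟩ := hΓ.natDegree_fPoly_le n (by omega)
    -- With n + 1 = D, r(A) is a multiple of A_{D+1} = 0, so every eigenvalue is a root of r, of
    -- degree at most D + 1.
    set r := Polynomial.X * Γ.fPoly (n + 1) - C (Γ.bNum n) * Γ.fPoly n with hr
    have hdeg : r.natDegree ≤ n + 2 := by
      refine (natDegree_sub_le _ _).trans (max_le ?_ ?_)
      · exact natDegree_mul_le.trans (by rw [natDegree_X]; omega)
      · exact (natDegree_C_mul_le _ _).trans (by omega)
    have hr0 : r ≠ 0 := by
      intro h0
      have h4 : r.coeff (n + 2) = 0 := by rw [h0, coeff_zero]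
      rw [hr, coeff_sub, coeff_C_mul, coeff_X_mul,
        coeff_eq_zero_of_natDegree_lt (p := Γ.fPoly n) (by omega), mul_zero, sub_zero] at h4
      exact h2 h4
    have hann : aeval (Γ.distMatrix ℝ 1) r = 0 := by
      rw [hr, map_sub, map_mul, aeval_X, ← Polynomial.smul_eq_C_mul, map_smul,
        hΓ.aeval_fPoly hb hD ℝ _ (by omega), hΓ.aeval_fPoly hb hD ℝ _ (by omega),
        hΓ.distMatrix_one_mul hb hD, distMatrix_eq_zero hΓ.connected ℝ (i := n + 2) (by omega)]
      simp
    have hsub : (Γ.distMatrix ℝ 1).charpoly.roots.toFinset ⊆ r.roots.toFinset := by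
      intro μ hμ
      have h5 := spectrum.subset_polynomial_aeval (Γ.distMatrix ℝ 1) r
        ⟨μ, mem_spectrum_iff_mem_roots.mpr hμ, rfl⟩
      rw [hann, spectrum.zero_eq, Set.mem_singleton_iff] at h5
      rw [Multiset.mem_toFinset, mem_roots hr0]
      exact h5
    calc _ ≤ r.roots.toFinset.card := Finset.card_le_card hsub
      _ ≤ Multiset.card r.roots := Multiset.toFinset_card_le _
      _ ≤ r.natDegree := card_roots' r
      _ ≤ _ := by omega
  -- A is diagonalizable, so the product of λ - μ over the distinct eigenvalues kills it and must
  -- have degree above D.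
  · have h := hΓ.connected.diam_lt_natDegree
      (monic_prod_of_monic _ _ fun μ _ => monic_X_sub_C μ).ne_zero
      (aeval_prod_roots_of_isHermitian (isHermitian_distMatrix Γ ℝ 1))
    rwa [natDegree_prod_of_monic _ _ fun μ _ => monic_X_sub_C μ, Finset.sum_congr rfl
      (fun μ _ => natDegree_X_sub_C μ), Finset.sum_const, smul_eq_mul, mul_one] at h

theorem IsDistanceRegular.theta_half_diam (hΓ : Γ.IsDistanceRegular) (hb : Γ.IsBipartite)
    (hD : 1 ≤ Γ.diam) (he : Even Γ.diam) : Γ.theta (Γ.diam / 2) = 0 := by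
  refine sort_getD_eq_zero_of_neg_mem (fun μ hμ => ?_) ?_
  · rw [← mem_spectrum_iff_mem_roots] at hμ ⊢
    exact hb.neg_mem_spectrum hμ
  · rw [hΓ.card_roots_charpoly hb hD]
    rw [Nat.even_iff] at he
    omega

end Spectrum

/-! ### Distance matrices and dual idempotents as operators -/

noncomputable section

/-- The operator of the `i`-th distance matrix on the standard module. -/
def distOp (Γ : SimpleGraph X) (i : ℕ) : EuclideanSpace ℂ X →ₗ[ℂ] EuclideanSpace ℂ X :=
  Matrix.toEuclideanLin (Γ.distMatrix ℂ i)

/-- The operator of the `i`-th dual idempotent on the standard module. -/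
def dualOp (Γ : SimpleGraph X) (x : X) (i : ℕ) : EuclideanSpace ℂ X →ₗ[ℂ] EuclideanSpace ℂ X :=
  Matrix.toEuclideanLin (Γ.dualIdempotent x i)

end

section Operators

variable {Γ : SimpleGraph X} {x : X}

theorem toEuclideanLin_mul_apply (A B : Matrix X X ℂ) (w : EuclideanSpace ℂ X) :
    Matrix.toEuclideanLin (A * B) w = Matrix.toEuclideanLin A (Matrix.toEuclideanLin B w) := by
  ext z
  simp [Matrix.mulVec_mulVec]

theorem distOp_apply (i : ℕ) (w : EuclideanSpace ℂ X) (z : X) :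
    Γ.distOp i w z = ∑ y, if Γ.dist z y = i then w y else 0 := by
  simp [distOp, Matrix.mulVec, dotProduct, distMatrix]

theorem dualOp_apply (i : ℕ) (w : EuclideanSpace ℂ X) (z : X) :
    Γ.dualOp x i w z = if Γ.dist x z = i then w z else 0 := by
  simp [dualOp, dualIdempotent, Matrix.mulVec_diagonal]

theorem dualVec_eq (v : EuclideanSpace ℂ X) (i : ℕ) :
    Γ.dualVec x v i = Γ.dualOp x (i + 2) (Γ.distOp i v) :=
  toEuclideanLin_mul_apply _ _ _

theorem dualOp_dualOp_self (i : ℕ) (w : EuclideanSpace ℂ X) :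
    Γ.dualOp x i (Γ.dualOp x i w) = Γ.dualOp x i w := by
  ext z
  simp only [dualOp_apply]
  split_ifs <;> rfl

theorem dualOp_dualOp_of_ne {i j : ℕ} (h : i ≠ j) (w : EuclideanSpace ℂ X) :
    Γ.dualOp x i (Γ.dualOp x j w) = 0 := by
  ext z
  simp only [dualOp_apply, PiLp.zero_apply]
  split_ifs <;> first | rfl | omega

theorem isSymmetric_distOp (i : ℕ) : (Γ.distOp i).IsSymmetric :=
  Matrix.isSymmetric_toEuclideanLin_iff.mpr (isHermitian_distMatrix Γ ℂ i)

theorem isSymmetric_dualOp (i : ℕ) : (Γ.dualOp x i).IsSymmetric := by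
  refine Matrix.isSymmetric_toEuclideanLin_iff.mpr ?_
  refine Matrix.isHermitian_diagonal_of_self_adjoint _ ?_
  ext z
  simp only [Pi.star_apply]
  split_ifs <;> simp

theorem distOp_zero (hΓ : Γ.Connected) (w : EuclideanSpace ℂ X) : Γ.distOp 0 w = w := by
  ext z
  simp [distOp_apply, hΓ.dist_eq_zero_iff]

theorem distOp_eq_zero (hΓ : Γ.Connected) {i : ℕ} (hi : Γ.diam < i) (w : EuclideanSpace ℂ X) :
    Γ.distOp i w = 0 := by
  rw [distOp, distMatrix_eq_zero hΓ ℂ hi, map_zero, LinearMap.zero_apply]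

theorem dualOp_eq_zero (hΓ : Γ.Connected) {i : ℕ} (hi : Γ.diam < i) (w : EuclideanSpace ℂ X) :
    Γ.dualOp x i w = 0 := by
  ext z
  have := hΓ.dist_le_diam_of_fintype x z
  simp [dualOp_apply, show Γ.dist x z ≠ i by omega]

theorem IsDistanceRegular.distOp_one_distOp (hΓ : Γ.IsDistanceRegular) (hb : Γ.IsBipartite)
    (hD : 1 ≤ Γ.diam) (i : ℕ) (w : EuclideanSpace ℂ X) :
    Γ.distOp 1 (Γ.distOp (i + 1) w) =
      (Γ.bNum i : ℂ) • Γ.distOp i w + (Γ.cNum (i + 2) : ℂ) • Γ.distOp (i + 2) w := by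
  rw [distOp, distOp, ← toEuclideanLin_mul_apply, hΓ.distMatrix_one_mul hb hD, map_add,
    LinearMap.add_apply, ← Complex.coe_smul, ← Complex.coe_smul, map_smul, map_smul]
  rfl

theorem dist_eq_add_one_or_of_dist_eq_one (hb : Γ.IsBipartite) (hΓ : Γ.Connected) {y z : X}
    (h : Γ.dist z y = 1) : Γ.dist x y = Γ.dist x z + 1 ∨ Γ.dist x y + 1 = Γ.dist x z := by
  have h1 := hb.even_dist_add hΓ x z y
  have h2 : Γ.dist x y ≤ Γ.dist x z + Γ.dist z y := hΓ.dist_triangle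
  have h3 : Γ.dist x z ≤ Γ.dist x y + Γ.dist y z := hΓ.dist_triangle
  rw [dist_comm (u := y)] at h3
  rw [Nat.even_iff] at h1
  omega

/-- Adjacent vertices differ by exactly one in distance from x, so A is a raising plus a lowering
part. Taking w = A_j v gives the two-way evaluations used below. -/
theorem dualOp_distOp_one (hb : Γ.IsBipartite) (hΓ : Γ.Connected) (n : ℕ)
    (w : EuclideanSpace ℂ X) :
    Γ.dualOp x (n + 1) (Γ.distOp 1 w) =
      Γ.dualOp x (n + 1) (Γ.distOp 1 (Γ.dualOp x n w)) +
        Γ.dualOp x (n + 1) (Γ.distOp 1 (Γ.dualOp x (n + 2) w)) := by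
  ext z
  simp only [PiLp.add_apply, dualOp_apply, distOp_apply]
  split_ifs with h
  · rw [← Finset.sum_add_distrib]
    refine Finset.sum_congr rfl fun y _ => ?_
    split_ifs with h1 h2 h3 h3 <;> try omega
    · simp
    · simp
    · have := dist_eq_add_one_or_of_dist_eq_one (x := x) hb hΓ h1
      omega
    · simp
  · simp

theorem distOp_one_dualOp (hb : Γ.IsBipartite) (hΓ : Γ.Connected) (n : ℕ)
    (w : EuclideanSpace ℂ X) :
    Γ.distOp 1 (Γ.dualOp x (n + 1) w) =
      Γ.dualOp x n (Γ.distOp 1 (Γ.dualOp x (n + 1) w)) +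
        Γ.dualOp x (n + 2) (Γ.distOp 1 (Γ.dualOp x (n + 1) w)) := by
  ext z
  simp only [PiLp.add_apply, dualOp_apply, distOp_apply]
  by_cases h1 : Γ.dist x z = n
  · simp [h1]
  by_cases h2 : Γ.dist x z = n + 2
  · simp [h2]
  rw [if_neg h1, if_neg h2, add_zero]
  refine Finset.sum_eq_zero fun y _ => ?_
  split_ifs with h3 h4 <;> try rfl
  have := dist_eq_add_one_or_of_dist_eq_one (x := x) hb hΓ h3
  omega

end Operators

/-! ### Vectors supported on the second subconstituent -/

section SecondSubconstituent

variable {Γ : SimpleGraph X} {x : X} {v : EuclideanSpace ℂ X}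

theorem eq_zero_of_dualOp_eq {i : ℕ} (hv : Γ.dualOp x i v = v) {y : X} (hy : Γ.dist x y ≠ i) :
    v y = 0 := by
  rw [← hv, dualOp_apply, if_neg hy]

theorem dualOp_distOp_eq_zero (hb : Γ.IsBipartite) (hΓ : Γ.Connected) (hv : Γ.dualOp x 2 v = v)
    {i j : ℕ} (h1 : j ≠ i + 2) (h2 : j ≠ i) (h3 : j + 2 ≠ i) :
    Γ.dualOp x j (Γ.distOp i v) = 0 := by
  ext z
  rw [dualOp_apply, distOp_apply, PiLp.zero_apply]
  split_ifs with hz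
  · refine Finset.sum_eq_zero fun y _ => ?_
    split_ifs with hy
    · refine eq_zero_of_dualOp_eq hv fun hxy => ?_
      have e1 := hb.even_dist_add hΓ x z y
      have e2 : Γ.dist x y ≤ Γ.dist x z + Γ.dist z y := hΓ.dist_triangle
      have e3 : Γ.dist x z ≤ Γ.dist x y + Γ.dist y z := hΓ.dist_triangle
      have e4 : Γ.dist z y ≤ Γ.dist z x + Γ.dist x y := hΓ.dist_triangle
      rw [dist_comm (u := y)] at e3
      rw [dist_comm (u := z) (v := x)] at e4
      rw [Nat.even_iff] at e1
      omega
    · rfl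
  · rfl

/-- From a vertex at distance n + 2 from x, the support of v is only seen at distances n, n + 2 and
n + 4, so every entry on the left is 0 or the sum of all entries of v. -/
theorem dualOp_distOp_add_add (hb : Γ.IsBipartite) (hΓ : Γ.Connected) (hv : Γ.dualOp x 2 v = v)
    (hsum : ∑ y, v y = 0) (n : ℕ) :
    Γ.dualOp x (n + 2) (Γ.distOp n v) + Γ.dualOp x (n + 2) (Γ.distOp (n + 2) v) +
      Γ.dualOp x (n + 2) (Γ.distOp (n + 4) v) = 0 := by
  ext z
  simp only [PiLp.add_apply, dualOp_apply, distOp_apply, PiLp.zero_apply]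
  split_ifs with hz
  · rw [← Finset.sum_add_distrib, ← Finset.sum_add_distrib]
    refine Eq.trans (Finset.sum_congr rfl fun y _ => ?_) hsum
    by_cases hxy : Γ.dist x y = 2
    · have e1 := hb.even_dist_add hΓ x z y
      have e2 : Γ.dist x y ≤ Γ.dist x z + Γ.dist z y := hΓ.dist_triangle
      have e3 : Γ.dist x z ≤ Γ.dist x y + Γ.dist y z := hΓ.dist_triangle
      have e4 : Γ.dist z y ≤ Γ.dist z x + Γ.dist x y := hΓ.dist_triangle
      rw [dist_comm (u := y)] at e3
      rw [dist_comm (u := z) (v := x)] at e4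
      rw [Nat.even_iff] at e1
      have : Γ.dist z y = n ∨ Γ.dist z y = n + 2 ∨ Γ.dist z y = n + 4 := by omega
      rcases this with h | h | h <;> simp [h]
    · simp [eq_zero_of_dualOp_eq hv hxy]
  · simp

theorem distOp_add_two_eq (hb : Γ.IsBipartite) (hΓ : Γ.Connected) (hv : Γ.dualOp x 2 v = v)
    (n : ℕ) : Γ.distOp (n + 2) v = Γ.dualOp x (n + 4) (Γ.distOp (n + 2) v) +
      Γ.dualOp x (n + 2) (Γ.distOp (n + 2) v) + Γ.dualOp x n (Γ.distOp (n + 2) v) := by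
  ext z
  have h := dualOp_distOp_eq_zero (i := n + 2) (j := Γ.dist x z) hb hΓ hv
  simp only [PiLp.add_apply, dualOp_apply]
  by_cases h1 : Γ.dist x z = n + 4
  · simp [h1]
  by_cases h2 : Γ.dist x z = n + 2
  · simp [h2]
  by_cases h3 : Γ.dist x z = n
  · simp [h3]
  have h4 := congrArg (fun w : EuclideanSpace ℂ X => w z) (h h1 h2 (by omega))
  simp only [dualOp_apply, if_pos, PiLp.zero_apply] at h4
  simp [h1, h2, h3, h4]

/-- Raising sends `E*_{n+2} A_n v` to `c_{n+1} E*_{n+3} A_{n+1} v`. -/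
theorem IsDistanceRegular.raise_dualVec (hΓ : Γ.IsDistanceRegular) (hb : Γ.IsBipartite)
    (hD : 1 ≤ Γ.diam) (hv : Γ.dualOp x 2 v = v) (n : ℕ) :
    Γ.dualOp x (n + 3) (Γ.distOp 1 (Γ.dualVec x v n)) =
      (Γ.cNum (n + 1) : ℂ) • Γ.dualVec x v (n + 1) := by
  have h := dualOp_distOp_one (x := x) hb hΓ.connected (n + 2) (Γ.distOp n v)
  rw [dualOp_distOp_eq_zero hb hΓ.connected hv (i := n) (j := n + 2 + 2) (by omega) (by omega)
    (by omega), map_zero, map_zero, add_zero] at h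
  rw [dualVec_eq, dualVec_eq, ← h]
  cases n with
  | zero => rw [distOp_zero hΓ.connected, hΓ.cNum_one hD, Complex.ofReal_one, one_smul]
  | succ n =>
    rw [hΓ.distOp_one_distOp hb hD, map_add, map_smul, map_smul,
      dualOp_distOp_eq_zero hb hΓ.connected hv (i := n) (by omega) (by omega) (by omega), smul_zero,
      zero_add]

end SecondSubconstituent

/-! ### Lowering and the square norms -/

namespace IsDistanceRegular

variable {Γ : SimpleGraph X} {x : X} {v : EuclideanSpace ℂ X}

theorem dualVec_zero (hΓ : Γ.IsDistanceRegular) (hv : Γ.dualOp x 2 v = v) :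
    Γ.dualVec x v 0 = v := by
  rw [dualVec_eq, distOp_zero hΓ.connected, hv]

theorem lower_dualVec_one (hΓ : Γ.IsDistanceRegular) (hb : Γ.IsBipartite) (he : Even Γ.diam)
    (hD : 3 ≤ Γ.diam) (hv1 : Γ.dualOp x 1 (Γ.distOp 1 v) = 0)
    (hd : Γ.dualOp x 2 (Γ.distOp 2 v) = ((Γ.diagCoeff 0 - 1 : ℝ) : ℂ) • Γ.dualVec x v 0) :
    Γ.dualOp x 2 (Γ.distOp 1 (Γ.dualVec x v 1)) = (Γ.lowerCoeff 0 : ℂ) • Γ.dualVec x v 0 := by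
  have h := dualOp_distOp_one (x := x) hb hΓ.connected 1 (Γ.distOp 1 v)
  rw [hv1, map_zero, map_zero, zero_add, hΓ.distOp_one_distOp hb (by omega), map_add, map_smul,
    map_smul, hd, ← dualVec_eq (i := 1)] at h
  rw [← h, ← dualVec_eq (i := 0), hΓ.lowerCoeff_zero hb he hD, smul_smul, ← add_smul,
    hΓ.bNum_zero (by omega), ← hΓ.bNum_add_cNum hb (by omega) (show 2 ≤ Γ.diam by omega)]
  congr 1
  push_cast
  ring

/-- E*_{n+3} A A_{n+2} v is known from the product relation. Its part arriving from distance n + 2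
is (δ_n - 1) times a raised U_n; the rest is the lowered U_{n+2}. -/
theorem lower_dualVec_add_two (hΓ : Γ.IsDistanceRegular) (hb : Γ.IsBipartite) (he : Even Γ.diam)
    (hv : Γ.dualOp x 2 v = v) {n : ℕ} (hn : n + 4 ≤ Γ.diam)
    (hd0 : Γ.dualOp x (n + 2) (Γ.distOp (n + 2) v) =
      ((Γ.diagCoeff n - 1 : ℝ) : ℂ) • Γ.dualVec x v n)
    (hd1 : Γ.dualOp x (n + 3) (Γ.distOp (n + 3) v) =
      ((Γ.diagCoeff (n + 1) - 1 : ℝ) : ℂ) • Γ.dualVec x v (n + 1)) :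
    Γ.dualOp x (n + 3) (Γ.distOp 1 (Γ.dualVec x v (n + 2))) =
      (Γ.lowerCoeff (n + 1) : ℂ) • Γ.dualVec x v (n + 1) := by
  have h := dualOp_distOp_one (x := x) hb hΓ.connected (n + 2) (Γ.distOp (n + 2) v)
  rw [hd0, map_smul, map_smul, hΓ.raise_dualVec hb (by omega) hv,
    hΓ.distOp_one_distOp hb (by omega), map_add, map_smul, map_smul, hd1,
    ← dualVec_eq (i := n + 2), ← dualVec_eq (i := n + 1)] at h
  rw [← sub_eq_iff_eq_add'] at h
  rw [← h, hΓ.lowerCoeff_succ hb he hn, smul_smul, smul_smul, ← add_smul, ← sub_smul]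
  have hk : Γ.bNum (n + 3) + Γ.cNum (n + 3) = Γ.bNum (n + 1) + Γ.cNum (n + 1) := by
    rw [hΓ.bNum_add_cNum hb (by omega) (by omega), hΓ.bNum_add_cNum hb (by omega) (by omega)]
  congr 1
  norm_cast
  linear_combination -hk

/-- If `E*_{n+3} A_{n+3} v` is a multiple of `E*_{n+3} A_{n+1} v`, the factor is determined. -/
theorem dualOp_distOp_succ (hΓ : Γ.IsDistanceRegular) (hb : Γ.IsBipartite) (he : Even Γ.diam)
    (hv : Γ.dualOp x 2 v = v) (hsum : ∑ y, v y = 0) {n : ℕ} (hn : n + 3 < Γ.diam)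
    (hne : Γ.dualVec x v n ≠ 0)
    (hd : Γ.dualOp x (n + 2) (Γ.distOp (n + 2) v) =
      ((Γ.diagCoeff n - 1 : ℝ) : ℂ) • Γ.dualVec x v n)
    (hl : Γ.dualOp x (n + 2) (Γ.distOp 1 (Γ.dualVec x v (n + 1))) =
      (Γ.lowerCoeff n : ℂ) • Γ.dualVec x v n)
    (hs : ∃ s : ℂ, Γ.dualOp x (n + 3) (Γ.distOp (n + 3) v) = s • Γ.dualVec x v (n + 1)) :
    Γ.dualOp x (n + 3) (Γ.distOp (n + 3) v) =
      ((Γ.diagCoeff (n + 1) - 1 : ℝ) : ℂ) • Γ.dualVec x v (n + 1) := by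
  obtain ⟨s, hs⟩ := hs
  have h4 := dualOp_distOp_add_add hb hΓ.connected hv hsum n
  have h5 := dualOp_distOp_add_add hb hΓ.connected hv hsum (n + 1)
  rw [← dualVec_eq, hd] at h4
  rw [← dualVec_eq, hs] at h5
  have h4' : Γ.dualOp x (n + 2) (Γ.distOp (n + 4) v) =
      -(Γ.diagCoeff n : ℂ) • Γ.dualVec x v n := by
    push_cast at h4
    linear_combination (norm := module) h4
  have h5' : Γ.dualOp x (n + 3) (Γ.distOp (n + 5) v) = -(1 + s) • Γ.dualVec x v (n + 1) := by
    linear_combination (norm := module) h5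
  -- Two evaluations of E*_{n+2} A A_{n+5} v: through distance n + 3 it is -(1 + s)ℓ_n U_n, and by
  -- the product relation it is -b_{n+4} δ_n U_n. Hence 1 + s = δ_{n+1}.
  have h := dualOp_distOp_one (x := x) hb hΓ.connected (n + 1) (Γ.distOp (n + 5) v)
  rw [dualOp_distOp_eq_zero hb hΓ.connected hv (i := n + 5) (j := n + 1) (by omega) (by omega)
    (by omega), map_zero, map_zero, zero_add, h5', map_smul, map_smul, hl,
    hΓ.distOp_one_distOp hb (by omega), map_add, map_smul, map_smul, h4',
    dualOp_distOp_eq_zero hb hΓ.connected hv (i := n + 4 + 2) (by omega) (by omega)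
    (by omega), smul_zero, add_zero, smul_smul, smul_smul] at h
  have h6 := smul_left_injective ℂ hne h
  have h7 := congrArg (Complex.ofReal) (hΓ.diagCoeff_succ_mul_lowerCoeff hb he hn)
  have h8 : (Γ.lowerCoeff n : ℂ) ≠ 0 :=
    Complex.ofReal_ne_zero.mpr (hΓ.lowerCoeff_ne_zero hb he hn)
  push_cast at h7
  rw [hs]
  congr 1
  push_cast
  apply mul_left_cancel₀ h8
  linear_combination h6 - h7

/-- Raising and lowering are adjoint: the inner product of U_{n+1} with the raised U_n equals that
of the lowered U_{n+1} with U_n. -/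
theorem cNum_mul_norm_sq_dualVec (hΓ : Γ.IsDistanceRegular) (hb : Γ.IsBipartite)
    (hD : 1 ≤ Γ.diam) (hv : Γ.dualOp x 2 v = v) {n : ℕ}
    (hl : Γ.dualOp x (n + 2) (Γ.distOp 1 (Γ.dualVec x v (n + 1))) =
      (Γ.lowerCoeff n : ℂ) • Γ.dualVec x v n) :
    Γ.cNum (n + 1) * ‖Γ.dualVec x v (n + 1)‖ ^ 2 = Γ.lowerCoeff n * ‖Γ.dualVec x v n‖ ^ 2 := by
  have hproj : ∀ m, Γ.dualOp x (m + 2) (Γ.dualVec x v m) = Γ.dualVec x v m := fun m => by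
    rw [dualVec_eq, dualOp_dualOp_self]
  have h1 : inner ℂ (Γ.dualVec x v (n + 1)) (Γ.dualOp x (n + 3) (Γ.distOp 1 (Γ.dualVec x v n))) =
      inner ℂ (Γ.dualOp x (n + 2) (Γ.distOp 1 (Γ.dualVec x v (n + 1)))) (Γ.dualVec x v n) := by
    rw [← isSymmetric_dualOp (Γ := Γ) (x := x) (n + 3), hproj (n + 1),
      ← isSymmetric_distOp (Γ := Γ) 1, isSymmetric_dualOp (Γ := Γ) (x := x) (n + 2), hproj n]
  rw [hΓ.raise_dualVec hb hD hv, hl, inner_smul_right, inner_smul_left,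
    inner_self_eq_norm_sq_to_K, inner_self_eq_norm_sq_to_K, Complex.conj_ofReal] at h1
  apply Complex.ofReal_injective
  push_cast
  exact h1

end IsDistanceRegular

namespace IsDistanceRegular

variable {Γ : SimpleGraph X} {x : X} {v : EuclideanSpace ℂ X}

/-! ### The basis vectors -/

theorem dualVec_ne_zero_and (hΓ : Γ.IsDistanceRegular) (hb : Γ.IsBipartite) (he : Even Γ.diam)
    (hv0 : v ≠ 0) (hv : Γ.dualOp x 2 v = v) (hsum : ∑ y, v y = 0)
    (hv1 : Γ.dualOp x 1 (Γ.distOp 1 v) = 0)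
    (hη : Γ.dualOp x 2 (Γ.distOp 2 v) = ((Γ.bNum 3 - 1 : ℝ) : ℂ) • v)
    (hthin : ∀ n, n + 3 ≤ Γ.diam → Γ.dualVec x v n ≠ 0 →
      ∃ s : ℂ, Γ.dualOp x (n + 2) (Γ.distOp (n + 2) v) = s • Γ.dualVec x v n)
    (n : ℕ) (hn : n + 3 ≤ Γ.diam) :
    Γ.dualVec x v n ≠ 0 ∧
    Γ.dualOp x (n + 2) (Γ.distOp (n + 2) v) =
      ((Γ.diagCoeff n - 1 : ℝ) : ℂ) • Γ.dualVec x v n ∧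
    Γ.dualOp x (n + 2) (Γ.distOp 1 (Γ.dualVec x v (n + 1))) =
      (Γ.lowerCoeff n : ℂ) • Γ.dualVec x v n := by
  induction n with
  | zero =>
    have hd : Γ.dualOp x 2 (Γ.distOp 2 v) =
        ((Γ.diagCoeff 0 - 1 : ℝ) : ℂ) • Γ.dualVec x v 0 := by
      rw [hΓ.dualVec_zero hv, hΓ.diagCoeff_zero hb he (by omega), hη]
    refine ⟨?_, hd, hΓ.lower_dualVec_one hb he hn hv1 hd⟩
    rwa [hΓ.dualVec_zero hv]
  | succ n ih =>
    obtain ⟨h1, h2, h3⟩ := ih (by omega)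
    -- Thinness says something about U_{n+1} only once it is nonzero; the norm relation at n
    -- supplies this.
    have hne : Γ.dualVec x v (n + 1) ≠ 0 := by
      intro h0
      have h := hΓ.cNum_mul_norm_sq_dualVec hb (by omega) hv h3
      rw [h0, norm_zero, zero_pow two_ne_zero, mul_zero] at h
      exact mul_ne_zero (hΓ.lowerCoeff_ne_zero hb he (by omega))
        (pow_ne_zero 2 (norm_ne_zero_iff.mpr h1)) h.symm
    have hd := hΓ.dualOp_distOp_succ hb he hv hsum (by omega) h1 h2 h3 (hthin (n + 1) hn hne)
    exact ⟨hne, hd, hΓ.lower_dualVec_add_two hb he hv (by omega) h2 hd⟩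

theorem dualVec_diam_sub_two (hΓ : Γ.IsDistanceRegular) (hb : Γ.IsBipartite) (he : Even Γ.diam)
    (hv : Γ.dualOp x 2 v = v) {n : ℕ} (hn : n + 3 = Γ.diam)
    (hl : Γ.dualOp x (n + 2) (Γ.distOp 1 (Γ.dualVec x v (n + 1))) =
      (Γ.lowerCoeff n : ℂ) • Γ.dualVec x v n) :
    Γ.dualVec x v (n + 1) = 0 := by
  have h := hΓ.cNum_mul_norm_sq_dualVec hb (by omega) hv hl
  rw [hΓ.lowerCoeff_eq_zero hb he hn, zero_mul] at h
  have h1 := (mul_eq_zero.mp h).resolve_left (hΓ.cNum_pos (by omega) (by omega)).ne'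
  exact norm_eq_zero.mp (pow_eq_zero_iff two_ne_zero |>.mp h1)

theorem inner_dualVec_eq_zero {i j : ℕ} (hij : i ≠ j) :
    inner ℂ (Γ.dualVec x v i) (Γ.dualVec x v j) = 0 := by
  rw [dualVec_eq, dualVec_eq, isSymmetric_dualOp (Γ := Γ) (x := x) (i + 2),
    dualOp_dualOp_of_ne (by omega), inner_zero_right]

theorem norm_sq_dualVec (hΓ : Γ.IsDistanceRegular) (hb : Γ.IsBipartite) (he : Even Γ.diam)
    (hv : Γ.dualOp x 2 v = v)
    (hl : ∀ n, n + 3 ≤ Γ.diam → Γ.dualOp x (n + 2) (Γ.distOp 1 (Γ.dualVec x v (n + 1))) =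
      (Γ.lowerCoeff n : ℂ) • Γ.dualVec x v n) (n : ℕ) (hn : n + 3 ≤ Γ.diam) :
    ‖Γ.dualVec x v n‖ ^ 2 =
      -((Γ.kNum n * Γ.bNum n * Γ.bNum (n + 1) * Γ.cNum (n + 1) * Γ.cNum (n + 2)) /
          (Γ.kNum 1 * Γ.bNum 1 * Γ.bNum 2)) *
        ((Γ.PPoly (n + 2)).eval 0 / (Γ.PPoly n).eval 0) * ‖v‖ ^ 2 := by
  have hk1 := (hΓ.kNum_pos (i := 1) (by omega)).ne'
  have hb1 := (hΓ.bNum_pos (i := 1) (by omega)).ne'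
  have hb2 := (hΓ.bNum_pos (i := 2) (by omega)).ne'
  induction n with
  | zero =>
    have e := hΓ.cNum_mul_PPoly_of_even hb (i := 0) (by omega) Even.zero
    simp only [zero_add, PPoly_zero_eval_zero, mul_one] at e
    rw [hΓ.dualVec_zero hv, hΓ.kNum_zero, hΓ.bNum_zero (by omega), PPoly_zero_eval_zero]
    simp only [zero_add, hΓ.cNum_one (show 1 ≤ Γ.diam by omega)]
    field_simp
    linear_combination ‖v‖ ^ 2 * e
  | succ n ih =>
    have hc1 := (hΓ.cNum_pos (i := n + 1) (by omega) (by omega)).ne'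
    have hq0 := hΓ.PPoly_eval_zero_ne_zero hb he (i := n) (by omega)
    have hq1 := hΓ.PPoly_eval_zero_ne_zero hb he (i := n + 1) (by omega)
    have hq2 := hΓ.PPoly_eval_zero_ne_zero hb he (i := n + 2) (by omega)
    have hk := hΓ.kNum_mul_bNum hb (i := n) (by omega)
    have h := hΓ.cNum_mul_norm_sq_dualVec hb (by omega) hv (hl n (by omega))
    rw [ih (by omega), hk, lowerCoeff] at h
    apply mul_left_cancel₀ hc1
    rw [h]
    simp only [add_assoc, Nat.reduceAdd]
    field_simp

/-! ### Polynomials in the adjacency matrix -/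

theorem toEuclideanLin_aeval_pPoly_add_two (hΓ : Γ.IsDistanceRegular) (hb : Γ.IsBipartite)
    (v : EuclideanSpace ℂ X) {n : ℕ} (hn : n + 2 ≤ Γ.diam) :
    Matrix.toEuclideanLin (Polynomial.aeval (Γ.distMatrix ℂ 1) (Γ.pPoly (n + 2))) v =
      Γ.distOp (n + 2) v +
        Matrix.toEuclideanLin (Polynomial.aeval (Γ.distMatrix ℂ 1) (Γ.pPoly n)) v := by
  rw [pPoly_add_two, map_add, hΓ.aeval_fPoly hb (by omega) ℂ _ hn, map_add]
  rfl

theorem toEuclideanLin_aeval_pPoly_zero (hΓ : Γ.IsDistanceRegular) (hv : Γ.dualOp x 2 v = v) :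
    Matrix.toEuclideanLin (Polynomial.aeval (Γ.distMatrix ℂ 1) (Γ.pPoly 0)) v =
      Γ.dualVec x v 0 := by
  rw [pPoly_zero, map_one, hΓ.dualVec_zero hv, Matrix.toLpLin_one, LinearMap.id_apply]

theorem toEuclideanLin_aeval_pPoly_one (hΓ : Γ.IsDistanceRegular) (hb : Γ.IsBipartite)
    (hD : 1 ≤ Γ.diam) (hv : Γ.dualOp x 2 v = v) (hv1 : Γ.dualOp x 1 (Γ.distOp 1 v) = 0) :
    Matrix.toEuclideanLin (Polynomial.aeval (Γ.distMatrix ℂ 1) (Γ.pPoly 1)) v =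
      Γ.dualVec x v 1 := by
  have h := distOp_one_dualOp (x := x) hb hΓ.connected 1 v
  rw [hv, hv1, zero_add] at h
  rw [pPoly_one, hΓ.aeval_fPoly hb hD ℂ _ hD, dualVec_eq]
  exact h

/-- The sum telescopes: the lowest component E*_{n+2}A_{n+4}v = -δ_n U_n of A_{n+4}v cancels the δ_n
U_n left by p_{n+2}(A)v. The two starting cases have no such component, by the endpoint. -/
theorem toEuclideanLin_aeval_pPoly_eq (hΓ : Γ.IsDistanceRegular) (hb : Γ.IsBipartite)
    (hv : Γ.dualOp x 2 v = v) (hsum : ∑ y, v y = 0)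
    (hv1 : Γ.dualOp x 1 (Γ.distOp 1 v) = 0) (hv0' : Γ.dualOp x 0 (Γ.distOp 2 v) = 0)
    (hv1' : Γ.dualOp x 1 (Γ.distOp 3 v) = 0)
    (hd : ∀ n, n + 3 ≤ Γ.diam → Γ.dualOp x (n + 2) (Γ.distOp (n + 2) v) =
      ((Γ.diagCoeff n - 1 : ℝ) : ℂ) • Γ.dualVec x v n) :
    ∀ n, n + 3 ≤ Γ.diam →
      Matrix.toEuclideanLin (Polynomial.aeval (Γ.distMatrix ℂ 1) (Γ.pPoly (n + 2))) v =
        Γ.dualVec x v (n + 2) + (Γ.diagCoeff n : ℂ) • Γ.dualVec x v n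
  | 0, hn => by
    rw [hΓ.toEuclideanLin_aeval_pPoly_add_two hb v (by omega),
      hΓ.toEuclideanLin_aeval_pPoly_zero hv, distOp_add_two_eq hb hΓ.connected hv, hd 0 hn, hv0',
      ← dualVec_eq (i := 0 + 2)]
    push_cast
    module
  | 1, hn => by
    rw [hΓ.toEuclideanLin_aeval_pPoly_add_two hb v (by omega),
      hΓ.toEuclideanLin_aeval_pPoly_one hb (by omega) hv hv1,
      distOp_add_two_eq hb hΓ.connected hv, hd 1 hn, hv1', ← dualVec_eq (i := 1 + 2)]
    push_cast
    module
  | n + 2, hn => by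
    have ih := toEuclideanLin_aeval_pPoly_eq hΓ hb hv hsum hv1 hv0' hv1' hd n (by omega)
    have h := dualOp_distOp_add_add hb hΓ.connected hv hsum n
    rw [hd n (by omega), ← dualVec_eq (i := n)] at h
    rw [hΓ.toEuclideanLin_aeval_pPoly_add_two hb v (by omega), ih,
      distOp_add_two_eq hb hΓ.connected hv, hd (n + 2) hn, ← dualVec_eq (i := n + 2 + 2)]
    push_cast at h ⊢
    linear_combination (norm := module) h

theorem dualVec_eq_sum (hΓ : Γ.IsDistanceRegular) (hb : Γ.IsBipartite) (he : Even Γ.diam)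
    (hv : Γ.dualOp x 2 v = v) (hv1 : Γ.dualOp x 1 (Γ.distOp 1 v) = 0)
    (hp : ∀ n, n + 3 ≤ Γ.diam →
      Matrix.toEuclideanLin (Polynomial.aeval (Γ.distMatrix ℂ 1) (Γ.pPoly (n + 2))) v =
        Γ.dualVec x v (n + 2) + (Γ.diagCoeff n : ℂ) • Γ.dualVec x v n) :
    ∀ i, i + 2 ≤ Γ.diam → Γ.dualVec x v i =
      ∑ h ∈ Finset.range (i + 1) with h % 2 = i % 2,
        (((Γ.PPoly h).eval 0 / (Γ.PPoly i).eval 0 *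
          ((Γ.kNum i * Γ.bNum i * Γ.bNum (i + 1)) / (Γ.kNum h * Γ.bNum h * Γ.bNum (h + 1))) : ℝ) :
            ℂ) •
          Matrix.toEuclideanLin (Polynomial.aeval (Γ.distMatrix ℂ 1) (Γ.pPoly h)) v
  | 0, hi => by
    have hk := (hΓ.kNum_pos (i := 0) (by omega)).ne'
    have hb0 := (hΓ.bNum_pos (i := 0) (by omega)).ne'
    have hb1 := (hΓ.bNum_pos (i := 1) (by omega)).ne'
    have hq := hΓ.PPoly_eval_zero_ne_zero hb he (i := 0) (by omega)
    rw [zero_add, Finset.range_one, Finset.filter_singleton, if_pos rfl, Finset.sum_singleton,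
      hΓ.toEuclideanLin_aeval_pPoly_zero hv, div_self hq, div_self (by positivity), one_mul,
      Complex.ofReal_one, one_smul]
  | 1, hi => by
    have hk := (hΓ.kNum_pos (i := 1) (by omega)).ne'
    have hb0 := (hΓ.bNum_pos (i := 1) (by omega)).ne'
    have hb1 := (hΓ.bNum_pos (i := 2) (by omega)).ne'
    have hq := hΓ.PPoly_eval_zero_ne_zero hb he (i := 1) (by omega)
    have hs : (Finset.range (1 + 1)).filter (fun h => h % 2 = 1 % 2) = {1} := by decide
    rw [hs, Finset.sum_singleton,
      hΓ.toEuclideanLin_aeval_pPoly_one hb (by omega) hv hv1, div_self hq,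
      div_self (by positivity), one_mul, Complex.ofReal_one, one_smul]
  | n + 2, hi => by
    have ih := dualVec_eq_sum hΓ hb he hv hv1 hp n (by omega)
    have hk2 := (hΓ.kNum_pos (i := n + 2) (by omega)).ne'
    have hb2 := (hΓ.bNum_pos (i := n + 2) (by omega)).ne'
    have hb3 := (hΓ.bNum_pos (i := n + 3) (by omega)).ne'
    have hc1 := (hΓ.cNum_pos (i := n + 1) (by omega) (by omega)).ne'
    have hc2 := (hΓ.cNum_pos (i := n + 2) (by omega) (by omega)).ne'
    have hq0 := hΓ.PPoly_eval_zero_ne_zero hb he (i := n) (by omega)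
    have hq2 := hΓ.PPoly_eval_zero_ne_zero hb he (i := n + 2) (by omega)
    have e1 := hΓ.kNum_mul_bNum hb (i := n) (by omega)
    have e2 := hΓ.kNum_mul_bNum hb (i := n + 1) (by omega)
    have hU : Γ.dualVec x v (n + 2) =
        Matrix.toEuclideanLin (Polynomial.aeval (Γ.distMatrix ℂ 1) (Γ.pPoly (n + 2))) v +
          (-(Γ.diagCoeff n : ℂ)) • Γ.dualVec x v n := by
      rw [hp n (by omega)]
      module
    rw [sum_range_filter_mod_two_add_two, div_self hq2, div_self (by positivity), one_mul,
      Complex.ofReal_one, one_smul, hU, ih, Finset.smul_sum]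
    congr 1
    refine Finset.sum_congr rfl fun h hh => ?_
    rw [smul_smul]
    congr 1
    rw [← Complex.ofReal_neg, ← Complex.ofReal_mul]
    congr 1
    have hlt : h ≤ n := by
      rw [Finset.mem_filter, Finset.mem_range] at hh
      omega
    -- This identity turns -δ_n into the ratio of the coefficients belonging to n + 2 and n.
    have e : Γ.kNum n * Γ.bNum n * Γ.bNum (n + 1) =
        Γ.kNum (n + 2) * Γ.cNum (n + 2) * Γ.cNum (n + 1) := by
      rw [e1]
      linear_combination Γ.cNum (n + 1) * e2
    rw [e, diagCoeff]
    simp only [add_assoc, Nat.reduceAdd]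
    field_simp

end IsDistanceRegular

/-! ### Modules of the subconstituent algebra -/

section TModule

variable {Γ : SimpleGraph X} {x : X} {W : Submodule ℂ (EuclideanSpace ℂ X)}

theorem IsTModule.distOp_mem (hW : Γ.IsTModule x W) (hΓ : Γ.IsDistanceRegular)
    (hb : Γ.IsBipartite) (hD : 1 ≤ Γ.diam) (i : ℕ) {w : EuclideanSpace ℂ X} (hw : w ∈ W) :
    Γ.distOp i w ∈ W := by
  rcases le_or_gt i Γ.diam with hi | hi
  · refine hW _ ?_ w hw
    refine le_sup_left (a := Γ.boseMesner) ?_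
    rw [← hΓ.aeval_fPoly hb hD ℂ i hi, ← Polynomial.aeval_map_algebraMap ℂ]
    exact Polynomial.aeval_mem_adjoin_singleton ℂ _
  · rw [distOp_eq_zero hΓ.connected hi]
    exact W.zero_mem

theorem IsTModule.dualOp_mem (hW : Γ.IsTModule x W) (hΓ : Γ.Connected) (i : ℕ)
    {w : EuclideanSpace ℂ X} (hw : w ∈ W) : Γ.dualOp x i w ∈ W := by
  rcases le_or_gt i Γ.diam with hi | hi
  · refine hW _ ?_ w hw
    exact le_sup_right (a := Γ.boseMesner) (Algebra.subset_adjoin ⟨i, hi, rfl⟩)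
  · rw [dualOp_eq_zero hΓ hi]
    exact W.zero_mem

/-- A subspace invariant under the generators of `T(x)` is a `T(x)`-module. -/
theorem isTModule_of_forall_mem (h1 : ∀ w ∈ W, Γ.distOp 1 w ∈ W)
    (h2 : ∀ i, ∀ w ∈ W, Γ.dualOp x i w ∈ W) : Γ.IsTModule x W := by
  let S : Subalgebra ℂ (Matrix X X ℂ) :=
    { carrier := {B | ∀ w ∈ W, Matrix.toEuclideanLin B w ∈ W}
      mul_mem' := fun {a b} ha hb w hw => by
        rw [toEuclideanLin_mul_apply]
        exact ha _ (hb w hw)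
      add_mem' := fun {a b} ha hb w hw => by
        rw [map_add, LinearMap.add_apply]
        exact W.add_mem (ha w hw) (hb w hw)
      algebraMap_mem' := fun r w hw => by
        rw [Algebra.algebraMap_eq_smul_one, map_smul, LinearMap.smul_apply, Matrix.toLpLin_one]
        exact W.smul_mem r hw }
  have hS : Γ.subconstituentAlgebra x ≤ S := by
    refine sup_le (Algebra.adjoin_le ?_) (Algebra.adjoin_le ?_)
    · rintro _ rfl
      exact h1
    · rintro _ ⟨i, -, rfl⟩
      exact h2 i
  exact fun B hB => hS hB

theorem HasEndpoint.dualOp_eq_zero (hend : Γ.HasEndpoint x W 2) {i : ℕ} (hi : i < 2)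
    {w : EuclideanSpace ℂ X} (hw : w ∈ W) : Γ.dualOp x i w = 0 := by
  have hbot : Γ.dualPart x W i = ⊥ := by
    by_contra hne
    have := hend.2 ⟨by have := hend.1.1; omega, hne⟩
    omega
  have hmem : Γ.dualOp x i w ∈ Γ.dualPart x W i := Submodule.mem_map_of_mem hw
  rwa [hbot, Submodule.mem_bot] at hmem

theorem IsThin.exists_smul_eq (hthin : Γ.IsThin x W) {i : ℕ} (hi : i ≤ Γ.diam)
    {u w : EuclideanSpace ℂ X} (hu : u ∈ W) (hw : w ∈ W) (hu0 : Γ.dualOp x i u ≠ 0) :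
    ∃ s : ℂ, Γ.dualOp x i w = s • Γ.dualOp x i u := by
  obtain ⟨⟨t, ht⟩, h⟩ := finrank_le_one_iff.mp (hthin i hi)
  obtain ⟨a, ha⟩ := h ⟨Γ.dualOp x i u, Submodule.mem_map_of_mem hu⟩
  obtain ⟨b, hb⟩ := h ⟨Γ.dualOp x i w, Submodule.mem_map_of_mem hw⟩
  have ha' : a • t = Γ.dualOp x i u := congrArg Subtype.val ha
  have hb' : b • t = Γ.dualOp x i w := congrArg Subtype.val hb
  have ha0 : a ≠ 0 := by
    rintro rfl
    exact hu0 (by rw [← ha', zero_smul])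
  exact ⟨b * a⁻¹, by rw [← ha', ← hb', smul_smul, mul_assoc, inv_mul_cancel₀ ha0, mul_one]⟩

/-- Raising and lowering move along the chain of the U_n, which closes at both ends: lowering v
gives 0, and raising the last vector gives a multiple of the vanishing one. -/
theorem IsDistanceRegular.isTModule_span_dualVec (hΓ : Γ.IsDistanceRegular) (hb : Γ.IsBipartite)
    {v : EuclideanSpace ℂ X} (hv : Γ.dualOp x 2 v = v)
    (hv1 : Γ.dualOp x 1 (Γ.distOp 1 v) = 0) {D : ℕ} (hD : Γ.diam = D + 3)
    (hl : ∀ n, n + 3 ≤ Γ.diam → Γ.dualOp x (n + 2) (Γ.distOp 1 (Γ.dualVec x v (n + 1))) =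
      (Γ.lowerCoeff n : ℂ) • Γ.dualVec x v n) (hlast : Γ.dualVec x v (D + 1) = 0) :
    Γ.IsTModule x (Submodule.span ℂ (Set.range fun i : Fin (D + 1) => Γ.dualVec x v i)) := by
  set U := Submodule.span ℂ (Set.range fun i : Fin (D + 1) => Γ.dualVec x v i) with hU
  have hmem : ∀ n ≤ D, Γ.dualVec x v n ∈ U := fun n hn =>
    Submodule.subset_span ⟨⟨n, by omega⟩, rfl⟩
  have hgen : ∀ f : EuclideanSpace ℂ X →ₗ[ℂ] EuclideanSpace ℂ X,
      (∀ n ≤ D, f (Γ.dualVec x v n) ∈ U) → ∀ w ∈ U, f w ∈ U := by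
    intro f hf
    have : U ≤ U.comap f := by
      rw [hU, Submodule.span_le]
      rintro _ ⟨i, rfl⟩
      exact hf i (by omega)
    exact this
  refine isTModule_of_forall_mem (hgen _ fun n hn => ?_) fun i => hgen _ fun n hn => ?_
  · have h := distOp_one_dualOp (x := x) hb hΓ.connected (n + 1) (Γ.distOp n v)
    rw [← dualVec_eq, hΓ.raise_dualVec hb (by omega) hv] at h
    rw [h]
    refine U.add_mem ?_ (U.smul_mem _ ?_)
    · cases n with
      | zero =>
        rw [hΓ.dualVec_zero hv, hv1]
        exact U.zero_mem
      | succ n =>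
        rw [hl n (by omega)]
        exact U.smul_mem _ (hmem n (by omega))
    · rcases hn.lt_or_eq with hn | rfl
      · exact hmem _ hn
      · rw [hlast]
        exact U.zero_mem
  · rw [dualVec_eq]
    by_cases hi : i = n + 2
    · rw [hi, dualOp_dualOp_self, ← dualVec_eq]
      exact hmem n hn
    · rw [dualOp_dualOp_of_ne hi]
      exact U.zero_mem

end TModule

end SimpleGraph

/-! ### Proof of the theorem -/

theorem theorem14p6 {X : Type*} [Fintype X] [DecidableEq X] (Γ : SimpleGraph X)
    (hΓ : Γ.IsDistanceRegular) (hbip : Γ.IsBipartite)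
    (D : ℕ) (hD : Γ.diam = D) (hD4 : 4 ≤ D) (hDeven : Even D) (hk : 3 ≤ Γ.kNum 1)
    (x : X) (W : Submodule ℂ (EuclideanSpace ℂ X))
    (hW : Γ.IsIrreducibleTModule x W) (hthin : Γ.IsThin x W) (hend : Γ.HasEndpoint x W 2)
    (hη : Γ.HasLocalEigenvalue x W (Γ.tilde (Γ.theta (D / 2))))
    (v : EuclideanSpace ℂ X) (hv : v ∈ Γ.dualPart x W 2) (hv0 : v ≠ 0) :
    -- the quotients by `P_i(0)` below are genuine
    (∀ i ≤ D - 2, (Γ.PPoly i).eval 0 ≠ 0) ∧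
    -- the vectors `E*_{i+2} A_i v` as polynomials in `A` applied to `v`
    (∀ i ≤ D - 2, Γ.dualVec x v i =
      ∑ h ∈ Finset.range (i + 1) with h % 2 = i % 2,
        (((Γ.PPoly h).eval 0 / (Γ.PPoly i).eval 0 *
          ((Γ.kNum i * Γ.bNum i * Γ.bNum (i + 1)) / (Γ.kNum h * Γ.bNum h * Γ.bNum (h + 1))) : ℝ) :
            ℂ) •
          Matrix.toEuclideanLin (Polynomial.aeval (Γ.distMatrix ℂ 1) (Γ.pPoly h)) v) ∧
    Γ.dualVec x v (D - 2) = 0 ∧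
    -- a basis of `W`
    LinearIndependent ℂ (fun i : Fin (D - 2) => Γ.dualVec x v i) ∧
    Submodule.span ℂ (Set.range fun i : Fin (D - 2) => Γ.dualVec x v i) = W ∧
    -- mutually orthogonal, with the given square-norms
    (∀ i ≤ D - 3, ∀ j ≤ D - 3, i ≠ j → inner ℂ (Γ.dualVec x v i) (Γ.dualVec x v j) = 0) ∧
    (∀ i ≤ D - 3, ‖Γ.dualVec x v i‖ ^ 2 =
      -((Γ.kNum i * Γ.bNum i * Γ.bNum (i + 1) * Γ.cNum (i + 1) * Γ.cNum (i + 2)) /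
          (Γ.kNum 1 * Γ.bNum 1 * Γ.bNum 2)) *
        ((Γ.PPoly (i + 2)).eval 0 / (Γ.PPoly i).eval 0) * ‖v‖ ^ 2) := by
  have he : Even Γ.diam := hD ▸ hDeven
  -- From here d is D - 3, the index of the last nonzero vector, not D/2.
  obtain ⟨d, rfl⟩ := Nat.exists_eq_add_of_le' (show 3 ≤ D by omega)
  obtain ⟨hT, -, hirr⟩ := hW
  obtain ⟨w, hwW, hwv⟩ := hv
  have hvW : v ∈ W := hwv ▸ hT.dualOp_mem hΓ.connected 2 hwW
  have hv2 : Γ.dualOp x 2 v = v := by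
    rw [← hwv]
    exact SimpleGraph.dualOp_dualOp_self 2 w
  have hA : ∀ i, Γ.distOp i v ∈ W := fun i => hT.distOp_mem hΓ hbip (by omega) i hvW
  have hv1 := hend.dualOp_eq_zero one_lt_two (hA 1)
  have hv1' := hend.dualOp_eq_zero one_lt_two (hA 3)
  have hv0' := hend.dualOp_eq_zero two_pos (hA 2)
  -- The x-entry of A_2 v is the sum of v over the vertices at distance 2, where v is supported.
  have hsum : ∑ y, v y = 0 := by
    have h := congrArg (fun u : EuclideanSpace ℂ X => u x) hv0'
    simp only [SimpleGraph.dualOp_apply, SimpleGraph.dist_self, if_true, PiLp.zero_apply,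
      SimpleGraph.distOp_apply] at h
    rw [← h]
    refine Finset.sum_congr rfl fun y _ => ?_
    split_ifs with hy
    · rfl
    · exact SimpleGraph.eq_zero_of_dualOp_eq hv2 hy
  have hb2 : Γ.bNum 2 ≠ 0 := (hΓ.bNum_pos (by omega)).ne'
  have hη' : Γ.dualOp x 2 (Γ.distOp 2 v) = ((Γ.bNum 3 - 1 : ℝ) : ℂ) • v := by
    have h := hη v ⟨w, hwW, hwv⟩
    -- At the eigenvalue 0 the quotient -b_2 b_3 / (0 - b_2) reduces to b_3.
    have ht : Γ.tilde (Γ.theta ((d + 3) / 2)) = Γ.bNum 3 - 1 := by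
      rw [← hD, hΓ.theta_half_diam hbip (by omega) he, SimpleGraph.tilde,
        zero_pow two_ne_zero, zero_sub, div_neg, mul_div_cancel_left₀ _ hb2]
      ring
    rw [ht, SimpleGraph.toEuclideanLin_mul_apply, SimpleGraph.toEuclideanLin_mul_apply] at h
    change Γ.dualOp x 2 (Γ.distOp 2 (Γ.dualOp x 2 v)) = _ at h
    rwa [hv2] at h
  have hthin' : ∀ n, n + 3 ≤ Γ.diam → Γ.dualVec x v n ≠ 0 →
      ∃ s : ℂ, Γ.dualOp x (n + 2) (Γ.distOp (n + 2) v) = s • Γ.dualVec x v n := by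
    intro n hn hne
    rw [SimpleGraph.dualVec_eq] at hne ⊢
    exact hthin.exists_smul_eq (by omega) (hA n) (hA (n + 2)) hne
  have hmain := hΓ.dualVec_ne_zero_and hbip he hv0 hv2 hsum hv1 hη' hthin'
  have hl := fun n hn => (hmain n hn).2.2
  have hlast := hΓ.dualVec_diam_sub_two hbip he hv2 hD.symm (hl d hD.ge)
  have hp := hΓ.toEuclideanLin_aeval_pPoly_eq hbip hv2 hsum hv1 hv0' hv1'
    fun n hn => (hmain n hn).2.1
  refine ⟨fun i hi => hΓ.PPoly_eval_zero_ne_zero hbip he (by omega),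
    fun i hi => hΓ.dualVec_eq_sum hbip he hv2 hv1 hp i (by omega), hlast, ?_, ?_,
    fun i _ j _ hij => SimpleGraph.IsDistanceRegular.inner_dualVec_eq_zero hij,
    fun i hi => hΓ.norm_sq_dualVec hbip he hv2 hl i (by omega)⟩
  · exact linearIndependent_of_ne_zero_of_inner_eq_zero
      (fun i => (hmain i (by omega)).1)
      fun i j hij => SimpleGraph.IsDistanceRegular.inner_dualVec_eq_zero (Fin.val_ne_of_ne hij)
  · refine (hirr _ ?_ (hΓ.isTModule_span_dualVec hbip hv2 hv1 hD hl hlast)).resolve_left ?_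
    · rw [Submodule.span_le]
      rintro _ ⟨i, rfl⟩
      change Γ.dualVec x v i ∈ W
      rw [SimpleGraph.dualVec_eq]
      exact hT.dualOp_mem hΓ.connected _ (hA i)
    · intro hbot
      have h0 : Γ.dualVec x v 0 ∈
          Submodule.span ℂ (Set.range fun i : Fin (d + 1) => Γ.dualVec x v i) :=
        Submodule.subset_span ⟨⟨0, by omega⟩, rfl⟩
      rw [hbot, Submodule.mem_bot, hΓ.dualVec_zero hv2] at h0
      exact hv0 h0
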